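/- **Theorem (convergence of DPRGD).** Equip $\mathbb{R}^{d\times r}$ with the Euclidean (Frobenius) norm and let $\mathcal M\subset\mathbb{R}^{d\times r}$ be a compact smooth embedded submanifold. For $y\in\mathbb{R}^{d\times r}$ let $\mathcal P_{\mathcal M}(y)=\operatorname{argmin}_{z\in\mathcal M}\|z-y\|$, and let $\gamma>0$ be such that $\mathcal M$ is $2\gamma$-proximally smooth, i.e. $\mathcal P_{\mathcal M}(y)$ is a singleton whenever $\operatorname{dist}(y,\mathcal M)<2\gamma$. Put $\zeta=\max_{x,y\in\mathcal M}\|x-y\|$, and let $L_{\mathcal P}>0$ be a Lipschitz modulus (in operator norm) over $\mathcal M$ of the map $x\mapsto\mathcal P_{T_x\mathcal M}$, the orthogonal projection onto the tangent space. The Riemannian gradient of $g$ is $\mathrm{grad}\,g(x)=\mathcal P_{T_x\mathcal M}(\nabla g(x))$. For $\mathbf x=(x_1,\dots,x_n)\in\mathcal M^n$ let $\hat x=\frac1n\sum_i x_i$, let $\bar x\in\mathcal P_{\mathcal M}(\hat x)$, and let $\bar{\mathbf x}=(\bar x,\dots,\bar x)$; put $$\mathcal N=\{\mathbf x\in\mathcal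 M^n:\ \max_i\|x_i-\bar x\|\le\gamma/2\}.$$ *Network.* Let $G$ be a connected undirected graph on $\{1,\dots,n\}$ and $W\in\mathbb{R}^{n\times n}$ a symmetric doubly stochastic matrix such that, for $i\ne j$, $W_{ij}>0$ if $ij$ is an edge of $G$ and $W_{ij}=0$ otherwise; $0<W_{ii}<1$ for all $i$; the eigenvalues of $W$ lie in $(-1,1]$; and the second largest singular value $\sigma_2$ of $W$ lies in $[0,1)$. *Objectives.* Let $L_f,L_G\ge0$ and let $f_1,\dots,f_n$ be real functions on $\mathbb{R}^{d\times r}$, differentiable at the points of $\mathrm{conv}(\mathcal M)$, with $\|\nabla f_i(x)-\nabla f_i(y)\|\le L_f\|x-y\|$ for $x,y\in\mathrm{conv}(\mathcal M)$ and $\|\nabla f_i(x)\|\le L_G$ for $x\in\mathcal M$. Put $f=\frac1n\sum_i f_i$, $L_g=L_f+\frac{L_G}{2\gamma}$ and $L=\max\{L_G,\,L_g,\,L_f+L_GL_{\mathcal P}\}$. *Algorithm.* Let $t\ge1$ be an integer with $$t\ \ge\ \max\Big\{\lceil\log_{\sigma_2}(1/2)\rceil,\ \Big\lceil\log_{\sigma_2}\Big(\frac{\gamma}{24\sqrt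 n\,\zeta}\Big)\Big\rceil\Big\}$$ (a threshold in which $\sigma_2=0$ or $\zeta=0$ occurs is read as $0$), let $\alpha_k=\frac1{\sqrt{k+1}}\min\{\frac{\gamma}{24L},1\}$ for $k\ge0$ (with $\frac{\gamma}{24L}=+\infty$ if $L=0$), and let $\mathbf x_k=(x_{1,k},\dots,x_{n,k})$, $k\ge 0$, satisfy $\mathbf x_0\in\mathcal N$ and $$x_{i,k+1}\in\mathcal P_{\mathcal M}\Big(\sum_{j=1}^n (W^t)_{ij}\,x_{j,k}-\alpha_k\,\mathrm{grad} f_i(x_{i,k})\Big),\qquad i=1,\dots,n,\ k\ge0 .$$ Then there are constants $C_1,C_2$, independent of $K$ and of the sequence $(\mathbf x_k)_k$ (they may depend on $\mathcal M,\gamma,L_{\mathcal P},W,t$, the $f_i$ and $L_f,L_G$), such that $$\frac1n\|\bar{\mathbf x}_K-\mathbf x_K\|^2=\frac1n\sum_{i=1}^n\|\bar x_K-x_{i,K}\|^2\le\frac{C_1}{K}\quad(K\ge1),\qquad \min_{0\le k\le K}\|\mathrm{grad} f(\bar x_k)\|^2\le\frac{C_2}{\sqrt{K+1}}\quad(K\ge0).$$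 -/

import Mathlib

open scoped ContDiff

noncomputable section

namespace DPRGD

section Geometry

variable {E : Type*} [NormedAddCommGroup E] [InnerProductSpace ℝ E]

/-- The (set-valued) nearest-point projection `P_M(y) = argmin_{z ∈ M} ‖z - y‖`. -/
def nearestPoints (M : Set E) (y : E) : Set E :=
  {z | z ∈ M ∧ ∀ w ∈ M, ‖z - y‖ ≤ ‖w - y‖}

/-- `M` is `R`-proximally smooth: it is closed and the nearest-point projection onto `M` is a
singleton at every point whose distance to `M` is less than `R`. -/
def IsProximallySmooth (R : ℝ) (M : Set E) : Prop :=
  IsClosed M ∧ ∀ y : E, Metric.infDist y M < R → ∃! z : E, z ∈ nearestPoints M y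

/-- `M` is a smooth (embedded, `C^∞`) `p`-dimensional submanifold of the Euclidean space `E`:
around each of its points, `M` is the zero set of a smooth map `h` with values in `ℝ^k`,
`k = dim E - p`, whose differential at that point is onto. -/
def IsSmoothSubmanifold (p : ℕ) (M : Set E) : Prop :=
  ∃ k : ℕ, p + k = Module.finrank ℝ E ∧
    ∀ x ∈ M, ∃ U : Set E, IsOpen U ∧ x ∈ U ∧
      ∃ h : E → EuclideanSpace ℝ (Fin k),
        ContDiffOn ℝ ∞ h U ∧ (∀ y ∈ U, y ∈ M ↔ h y = 0) ∧
          Function.Surjective (fderiv ℝ h x)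

/-- The tangent space `T_x M`: all velocities at `x` of curves in `M` through `x`.
(For a submanifold these velocities already form a linear subspace; the span only serves to
give the type `Submodule ℝ E`.) -/
def tangentSpace (M : Set E) (x : E) : Submodule ℝ E :=
  Submodule.span ℝ
    {v | ∃ c : ℝ → E, c 0 = x ∧ (∀ᶠ s in nhds (0 : ℝ), c s ∈ M) ∧ HasDerivAt c v 0}

/-- The Euclidean average `x̂ = (1/n) ∑ i, x i`. -/
def mean {n : ℕ} (x : Fin n → E) : E := (n : ℝ)⁻¹ • ∑ i, x i

/-- The neighborhood `𝒩 = {x ∈ M^n : max_i ‖x_i - x̄‖ ≤ γ/2}`, where `x̄ ∈ P_M(x̂)`. -/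
def consensusNhd (n : ℕ) (M : Set E) (γ : ℝ) : Set (Fin n → E) :=
  {x | (∀ i, x i ∈ M) ∧ ∃ xbar ∈ nearestPoints M (mean x), ∀ i, ‖x i - xbar‖ ≤ γ / 2}

/-- The global objective `f(z) = (1/n) ∑ i, f_i(z)`. -/
def average {n : ℕ} (f : Fin n → E → ℝ) (z : E) : ℝ := (n : ℝ)⁻¹ * ∑ i, f i z

variable [FiniteDimensional ℝ E]

/-- The orthogonal projection of `E` onto `T_x M`, as a linear endomorphism of `E`. -/
def tangentProj (M : Set E) (x : E) : E →L[ℝ] E := (tangentSpace M x).starProjection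

/-- The Riemannian gradient of `f` on the submanifold `M` with the Euclidean metric:
the orthogonal projection of the Euclidean gradient onto the tangent space. -/
def rgrad (M : Set E) (f : E → ℝ) (x : E) : E := tangentProj M x (gradient f x)

/-- The assumption on the local objectives: each `f_i` is differentiable on `conv M` with
`Lf`-Lipschitz gradient there, and its gradient is bounded by `LG` on `M`. -/
structure ObjectiveAssumption {n : ℕ} (M : Set E) (f : Fin n → E → ℝ) (Lf LG : ℝ) : Prop where
  differentiableAt : ∀ i, ∀ x ∈ convexHull ℝ M, DifferentiableAt ℝ (f i) x
  gradient_lipschitz : ∀ i, ∀ x ∈ convexHull ℝ M, ∀ y ∈ convexHull ℝ M,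
    ‖gradient (f i) x - gradient (f i) y‖ ≤ Lf * ‖x - y‖
  gradient_bound : ∀ i, ∀ x ∈ M, ‖gradient (f i) x‖ ≤ LG

/-- `x` is a sequence of iterates of the decentralized projected Riemannian gradient descent
method: `x_{i,k+1} ∈ P_M(∑ j, (W^t)_{ij} x_{j,k} - α_k grad f_i(x_{i,k}))` for all `i`, `k`. -/
def IsDPRGD {n : ℕ} (M : Set E) (W : Matrix (Fin n) (Fin n) ℝ) (t : ℕ) (f : Fin n → E → ℝ)
    (α : ℕ → ℝ) (x : ℕ → Fin n → E) : Prop :=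
  ∀ k i, x (k + 1) i ∈
    nearestPoints M (∑ j, (W ^ t) i j • x k j - α k • rgrad M (f i) (x k i))

end Geometry

section Network

variable {n : ℕ}

/-- The second largest singular value of `W` (Mathlib's singular values are listed in
decreasing order with multiplicity, starting from index `0`). -/
def sigmaTwo (W : Matrix (Fin n) (Fin n) ℝ) : ℝ := (Matrix.toEuclideanLin W).singularValues 1

/-- The assumption on the network: `G` is connected, and `W` is a symmetric doubly stochastic
matrix adapted to `G`, with diagonal entries in `(0,1)`, eigenvalues in `(-1,1]` and second
largest singular value in `[0,1)`. -/
structure NetworkAssumption (G : SimpleGraph (Fin n)) (W : Matrix (Fin n) (Fin n) ℝ) :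
    Prop where
  connected : G.Connected
  pos_of_adj : ∀ i j, G.Adj i j → 0 < W i j
  eq_zero_of_not_adj : ∀ i j, i ≠ j → ¬ G.Adj i j → W i j = 0
  doubly_stochastic : W ∈ doublyStochastic ℝ (Fin n)
  symm : W.IsSymm
  diag_pos : ∀ i, 0 < W i i
  diag_lt_one : ∀ i, W i i < 1
  eigenvalues : ∀ μ : ℝ, Module.End.HasEigenvalue (Matrix.toLin' W) μ → -1 < μ ∧ μ ≤ 1
  sigmaTwo_nonneg : 0 ≤ sigmaTwo W
  sigmaTwo_lt_one : sigmaTwo W < 1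

end Network

/-- The constant `L = max {L_G, L_g, L_f + L_G L_P}`, where `L_g = L_f + L_G / (2γ)`. -/
def bigL (γ Lf LG LP : ℝ) : ℝ := max LG (max (Lf + LG / (2 * γ)) (Lf + LG * LP))

/-- The step size `α_k = min {γ/(24L), 1} / √(k+1)`, with `γ/(24L)` read as `+∞` if `L = 0`. -/
def stepSize (γ L : ℝ) (k : ℕ) : ℝ :=
  (if L = 0 then 1 else min (γ / (24 * L)) 1) / √((k : ℝ) + 1)

end DPRGD

end

/-! The geometric input is the proximal normal inequality (`IsProximallySmooth.inner_le`):
nearest-point residuals see other points of `M` only to second order, with constant governed by the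
radius of proximal smoothness. It makes the projection Lipschitz on tubes
(`IsProximallySmooth.norm_sub_le`) and keeps points of `M` quadratically close to tangent planes
(`IsSmoothSubmanifold.inner_normal_le`).

Consensus: gossip contracts deviations from the mean by `σ₂ ^ t ≤ 1/2`, while projecting expands by
at most `96/71`. The squared deviation `V` thus satisfies `V (k+1) ≤ 0.49 * V k + O(1/(k+1))`, so `V
k = O(1/(k+1))`. The second threshold on `t` and the cap on the step size keep the iterates in the
neighborhood where these constants hold (`isProjectedStep_iterates`).

Optimality: the induced means move by `-α_k • grad f` at the current mean, with error `O(1/(k+1))`.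
Projection errors are quadratic in the disagreement, of order `1/√(k+1)`, or carry an extra factor
`α_k` (`IsProjectedStep.norm_center_sub_le`); evaluating gradients at the agents costs `α_k` times
the disagreement. The Riemannian descent inequality gives a decrease of `α_k / 2 * ‖grad f‖ ^ 2` up
to `O((k+1)^(-3/2))`. These errors are summable, `f` is bounded on `M`, and the sum of `1/√(k+1)`
over `k ≤ K` is at least `√(K+1)`, which yields the rate (`inf'_le_of_sufficient_decrease`). -/

namespace DPRGD

/-! ### Nearest points and the proximal normal inequality -/

section ProximalSmoothness

variable {E : Type*} [NormedAddCommGroup E]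

theorem infDist_eq_of_mem_nearestPoints {M : Set E} {y q : E} (hq : q ∈ nearestPoints M y) :
    Metric.infDist y M = ‖q - y‖ := by
  apply le_antisymm
  · rw [← dist_eq_norm, dist_comm]
    exact Metric.infDist_le_dist_of_mem hq.1
  · refine (Metric.le_infDist ⟨q, hq.1⟩).2 fun w hw => ?_
    rw [dist_comm, dist_eq_norm]
    exact hq.2 w hw

theorem nonempty_nearestPoints {M : Set E} (hM : IsCompact M) (hne : M.Nonempty) (y : E) :
    (nearestPoints M y).Nonempty := by
  obtain ⟨q, hq, h⟩ := hM.exists_isMinOn hne (f := fun w => ‖w - y‖) (by fun_prop)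
  exact ⟨q, hq, fun w hw => h hw⟩

theorem IsProximallySmooth.eq_of_mem {R : ℝ} {M : Set E} (hM : IsProximallySmooth R M) {y q q' : E}
    (hq : q ∈ nearestPoints M y) (hq' : q' ∈ nearestPoints M y) (h : ‖q - y‖ < R) : q' = q := by
  rw [← infDist_eq_of_mem_nearestPoints hq] at h
  exact (hM.2 y h).unique hq' hq

/-- The nearest-point projection is continuous at the points where it is single-valued. -/
theorem exists_ball_nearestPoints_near {M : Set E} (hM : IsCompact M) {z q : E}
    (hq : q ∈ nearestPoints M z) (huniq : ∀ q' ∈ nearestPoints M z, q' = q) {η : ℝ} (hη : 0 < η) :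
    ∃ ρ > 0, ∀ z', ‖z' - z‖ < ρ → ∀ q' ∈ nearestPoints M z', ‖q' - q‖ < η := by
  have hK : IsCompact (M \ Metric.ball q η) := hM.diff Metric.isOpen_ball
  rcases (M \ Metric.ball q η).eq_empty_or_nonempty with he | hne
  · refine ⟨1, one_pos, fun z' _ q' hq' => ?_⟩
    by_contra hc
    have : q' ∈ M \ Metric.ball q η := ⟨hq'.1, by simpa [dist_eq_norm] using hc⟩
    simp [he] at this
  · obtain ⟨m, hm, hmin⟩ := hK.exists_isMinOn hne (f := fun w => ‖w - z‖) (by fun_prop)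
    have hlt : ‖q - z‖ < ‖m - z‖ := by
      refine lt_of_le_of_ne (hq.2 m hm.1) fun he => hm.2 ?_
      rw [huniq m ⟨hm.1, fun w hw => he ▸ hq.2 w hw⟩]
      exact Metric.mem_ball_self hη
    refine ⟨(‖m - z‖ - ‖q - z‖) / 2, by linarith, fun z' hz' q' hq' => ?_⟩
    by_contra hc
    have h1 : ‖m - z‖ ≤ ‖q' - z‖ := hmin ⟨hq'.1, by simpa [dist_eq_norm] using hc⟩
    have h2 := hq'.2 q hq.1
    have h3 : ‖q' - z‖ ≤ ‖q' - z'‖ + ‖z' - z‖ := norm_sub_le_norm_sub_add_norm_sub _ _ _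
    have h4 : ‖q - z'‖ ≤ ‖q - z‖ + ‖z - z'‖ := norm_sub_le_norm_sub_add_norm_sub _ _ _
    rw [norm_sub_rev z z'] at h4
    linarith

variable [InnerProductSpace ℝ E]

/-- At a point outside `M` with a unique nearest point, the distance to `M` grows with slope `1`
in the direction away from that nearest point. -/
theorem exists_infDist_growth {M : Set E} (hM : IsCompact M) {z q : E}
    (hq : q ∈ nearestPoints M z) (huniq : ∀ q' ∈ nearestPoints M z, q' = q) (hz : z ≠ q)
    {ε : ℝ} (hε : 0 < ε) (hε1 : ε ≤ 1) {h₀ : ℝ} (hh₀ : 0 < h₀) :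
    ∃ h, 0 < h ∧ h < h₀ ∧
      Metric.infDist z M + (1 - ε) * h ≤ Metric.infDist (z + (h / ‖z - q‖) • (z - q)) M := by
  set δ := ‖z - q‖ with hδ
  have hδ0 : 0 < δ := norm_pos_iff.2 (sub_ne_zero.2 hz)
  obtain ⟨ρ, hρ, H⟩ := exists_ball_nearestPoints_near hM hq huniq (η := ε * δ / 2) (by positivity)
  set h := min (h₀ / 2) (ρ / 2) with hh
  have hpos : 0 < h := by positivity
  have hle : h ≤ ρ / 2 := min_le_right _ _
  refine ⟨h, hpos, lt_of_le_of_lt (min_le_left _ _) (by linarith), ?_⟩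
  obtain ⟨q', hq'⟩ := nonempty_nearestPoints hM ⟨q, hq.1⟩ (z + (h / δ) • (z - q))
  have hnear := H (z + (h / δ) • (z - q)) (by
    rw [add_sub_cancel_left, norm_smul, Real.norm_of_nonneg (by positivity), ← hδ,
      div_mul_cancel₀ _ hδ0.ne']
    linarith) q' hq'
  rw [infDist_eq_of_mem_nearestPoints hq', infDist_eq_of_mem_nearestPoints hq, norm_sub_rev q z,
    ← hδ, norm_sub_rev]
  have h1 : δ ≤ ‖z - q'‖ := by
    have := hq.2 q' hq'.1
    rwa [norm_sub_rev, norm_sub_rev q'] at this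
  -- Because `q'` is within `ε * δ / 2` of `q`, moving along `z - q` is nearly moving straight away
  -- from `q'`.
  have h2 : δ * (δ - ε * δ / 2) ≤ inner ℝ (z - q) (z - q') := by
    have e : z - q' = (z - q) - (q' - q) := by abel
    have := real_inner_le_norm (z - q) (q' - q)
    rw [e, inner_sub_right, real_inner_self_eq_norm_sq, ← hδ]
    nlinarith
  have h3 : ‖z + (h / δ) • (z - q) - q'‖ ^ 2
      = ‖z - q'‖ ^ 2 + 2 * (h / δ) * inner ℝ (z - q) (z - q') + h ^ 2 := by
    have e : z + (h / δ) • (z - q) - q' = (z - q') + (h / δ) • (z - q) := by abel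
    rw [e, norm_add_sq_real, inner_smul_right, norm_smul, Real.norm_of_nonneg (by positivity),
      ← hδ, div_mul_cancel₀ _ hδ0.ne', real_inner_comm]
    ring
  have h4 : 2 * h * (δ - ε * δ / 2) ≤ 2 * (h / δ) * inner ℝ (z - q) (z - q') := by
    calc 2 * h * (δ - ε * δ / 2) = 2 * (h / δ) * (δ * (δ - ε * δ / 2)) := by field_simp
      _ ≤ _ := by gcongr
  refine (abs_le_of_sq_le_sq' ?_ (norm_nonneg _)).2
  rw [h3]
  have h5 : δ ^ 2 ≤ ‖z - q'‖ ^ 2 := by gcongr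
  have h6 : 0 < ε * δ * h := by positivity
  have h7 : (1 - ε) ^ 2 * h ^ 2 ≤ 1 * h ^ 2 := by gcongr; nlinarith
  nlinarith

/-- If `q` is a nearest point of `q + s₀ v`, where `v` is a unit vector, then it remains a nearest
point of `q + s v` up to the radius of proximal smoothness. -/
theorem IsProximallySmooth.mem_nearestPoints_extend [FiniteDimensional ℝ E] {R : ℝ} {M : Set E}
    (hM : IsCompact M) (hprox : IsProximallySmooth R M) {q v : E} (hv : ‖v‖ = 1) {s₀ s : ℝ}
    (hs₀ : 0 < s₀) (hs : s₀ < s) (hsR : s < R) (hq : q ∈ nearestPoints M (q + s₀ • v)) :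
    q ∈ nearestPoints M (q + s • v) := by
  set y := q + s₀ • v with hy
  have hδy : Metric.infDist y M = s₀ := by
    rw [infDist_eq_of_mem_nearestPoints hq, hy, norm_sub_rev, add_sub_cancel_left, norm_smul, hv,
      Real.norm_of_nonneg hs₀.le, mul_one]
  set T := s - s₀ with hT
  have hT0 : 0 < T := sub_pos.2 hs
  have hball : IsCompact (Metric.closedBall y T) := isCompact_closedBall y T
  have hballne : (Metric.closedBall y T).Nonempty := ⟨y, Metric.mem_closedBall_self hT0.le⟩
  -- A variational argument replaces following the gradient flow of the distance. An interior
  -- maximizer of distance minus `(1 - ε) * ‖z - y‖` could be improved, since the distance grows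
  -- there with slope at least `1 - ε / 2`. The maximizer is therefore on the sphere of radius `T`.
  have key : ∀ ε : ℝ, 0 < ε → ε ≤ 1 →
      ∃ z ∈ Metric.closedBall y T, s₀ + (1 - ε) * T ≤ Metric.infDist z M := by
    intro ε hε hε1
    obtain ⟨z, hz, hmax⟩ := hball.exists_isMaxOn hballne
      (f := fun z => Metric.infDist z M - (1 - ε) * ‖z - y‖)
      (by
        have := Metric.continuous_infDist_pt M
        fun_prop)
    refine ⟨z, hz, ?_⟩
    have hzT : ‖z - y‖ ≤ T := by simpa [dist_eq_norm] using hz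
    have hφ : ∀ w, ‖w - y‖ ≤ T → Metric.infDist w M - (1 - ε) * ‖w - y‖ ≤
        Metric.infDist z M - (1 - ε) * ‖z - y‖ :=
      fun w hw => hmax (by simpa [dist_eq_norm] using hw)
    have h0 := hφ y (by simpa using hT0.le)
    rw [sub_self, norm_zero, mul_zero, sub_zero, hδy] at h0
    rcases hzT.eq_or_lt with he | hlt
    · rw [he] at h0; linarith
    exfalso
    have hεz : 0 ≤ (1 - ε) * ‖z - y‖ := mul_nonneg (by linarith) (norm_nonneg _)
    have hzR : Metric.infDist z M < R := by
      have := Metric.infDist_le_infDist_add_dist (s := M) (x := z) (y := y)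
      rw [hδy, dist_eq_norm] at this
      linarith
    obtain ⟨p, hp, hpu⟩ := hprox.2 z hzR
    have hzp : z ≠ p := by
      rintro rfl
      have := infDist_eq_of_mem_nearestPoints hp
      rw [sub_self, norm_zero] at this
      linarith
    obtain ⟨h, hh, hhT, hgrow⟩ := exists_infDist_growth hM hp hpu hzp (ε := ε / 2) (by linarith)
      (by linarith) (sub_pos.2 hlt)
    have hn : ‖(h / ‖z - p‖) • (z - p)‖ = h := by
      have : 0 < ‖z - p‖ := norm_pos_iff.2 (sub_ne_zero.2 hzp)
      rw [norm_smul, Real.norm_of_nonneg (by positivity), div_mul_cancel₀ _ this.ne']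
    have hw : ‖z + (h / ‖z - p‖) • (z - p) - y‖ ≤ ‖z - y‖ + h := by
      rw [add_sub_right_comm]
      exact (norm_add_le _ _).trans_eq (by rw [hn])
    have h1 := hφ (z + (h / ‖z - p‖) • (z - p)) (by linarith)
    have h2 : (1 - ε) * ‖z + (h / ‖z - p‖) • (z - p) - y‖ ≤ (1 - ε) * (‖z - y‖ + h) :=
      mul_le_mul_of_nonneg_left hw (by linarith)
    nlinarith [mul_pos hε hh]
  obtain ⟨z, hz, hmax⟩ := hball.exists_isMaxOn hballne (f := fun z => Metric.infDist z M)
    (Metric.continuous_infDist_pt M).continuousOn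
  have hzT : ‖z - y‖ ≤ T := by simpa [dist_eq_norm] using hz
  have hzs : s ≤ Metric.infDist z M := by
    by_contra hc
    push Not at hc
    -- With this `ε` the loss `ε * T` is at most half of the supposed deficit.
    obtain ⟨w, hw, hw'⟩ := key (min ((s - Metric.infDist z M) / (2 * T)) 1)
      (lt_min (div_pos (by linarith) (by linarith)) one_pos) (min_le_right _ _)
    have h1 : Metric.infDist w M ≤ Metric.infDist z M := hmax hw
    have h2 : min ((s - Metric.infDist z M) / (2 * T)) 1 * T ≤
        (s - Metric.infDist z M) / (2 * T) * T := by gcongr; exact min_le_left _ _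
    have h3 : (s - Metric.infDist z M) / (2 * T) * T = (s - Metric.infDist z M) / 2 := by
      field_simp
    nlinarith
  have hzq : s ≤ ‖z - q‖ := by
    rw [← dist_eq_norm]
    exact hzs.trans (Metric.infDist_le_dist_of_mem hq.1)
  -- Now `‖z - q‖ ≥ s₀ + T`, `‖y - q‖ = s₀` and `‖z - y‖ ≤ T`: equality in the triangle inequality
  -- forces `z` onto the ray from `q` along `v`.
  have hin : T ≤ inner ℝ v (z - y) := by
    have e : z - q = s₀ • v + (z - y) := by rw [hy]; abel
    have h1 : ‖z - q‖ ^ 2 = s₀ ^ 2 + 2 * (s₀ * inner ℝ v (z - y)) + ‖z - y‖ ^ 2 := by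
      rw [e, norm_add_sq_real, inner_smul_left, norm_smul, hv, Real.norm_of_nonneg hs₀.le]
      simp
    have h2 : s ^ 2 ≤ ‖z - q‖ ^ 2 := pow_le_pow_left₀ (by linarith) hzq 2
    have h3 : ‖z - y‖ ^ 2 ≤ T ^ 2 := by gcongr
    have h4 : s = s₀ + T := by rw [hT]; ring
    rw [h4] at h2
    by_contra hc
    push Not at hc
    nlinarith [mul_lt_mul_of_pos_left hc hs₀]
  have hzv : z = q + s • v := by
    have h1 : ‖(z - y) - T • v‖ ^ 2 ≤ 0 := by
      rw [norm_sub_sq_real, inner_smul_right, norm_smul, hv, Real.norm_of_nonneg hT0.le,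
        real_inner_comm]
      nlinarith [norm_nonneg (z - y)]
    have h2 : (z - y) - T • v = 0 := by
      rw [← norm_eq_zero]
      exact pow_eq_zero_iff two_ne_zero |>.1 (le_antisymm h1 (sq_nonneg _))
    have h3 : z = y + T • v := by rw [← sub_eq_zero, ← h2]; abel
    rw [h3, hy, add_assoc, ← add_smul, hT, add_sub_cancel]
  refine ⟨hq.1, fun w hw => ?_⟩
  rw [← hzv]
  calc ‖q - z‖ = s := by
        rw [hzv, norm_sub_rev, add_sub_cancel_left, norm_smul, hv,
          Real.norm_of_nonneg (by linarith), mul_one]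
    _ ≤ Metric.infDist z M := hzs
    _ ≤ ‖w - z‖ := by
        rw [← dist_eq_norm, dist_comm]
        exact Metric.infDist_le_dist_of_mem hw

/-- The proximal normal inequality on a proximally smooth set. -/
theorem IsProximallySmooth.inner_le [FiniteDimensional ℝ E] {R : ℝ} {M : Set E} (hR : 0 < R)
    (hM : IsCompact M) (hprox : IsProximallySmooth R M) {y q : E} (hq : q ∈ nearestPoints M y)
    (hyR : ‖y - q‖ < R) {w : E} (hw : w ∈ M) :
    inner ℝ (y - q) (w - q) ≤ ‖y - q‖ / (2 * R) * ‖w - q‖ ^ 2 := by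
  rcases eq_or_ne y q with rfl | hne
  · simp
  set s₀ := ‖y - q‖ with hs₀
  have hs₀0 : 0 < s₀ := norm_pos_iff.2 (sub_ne_zero.2 hne)
  set v := s₀⁻¹ • (y - q) with hv
  have hv1 : ‖v‖ = 1 := by
    rw [hv, norm_smul, norm_inv, Real.norm_of_nonneg hs₀0.le, ← hs₀, inv_mul_cancel₀ hs₀0.ne']
  have hvy : y - q = s₀ • v := by rw [hv, smul_smul, mul_inv_cancel₀ hs₀0.ne', one_smul]
  have hyv : y = q + s₀ • v := by rw [← hvy]; abel
  -- The point `w` lies outside the open ball of radius `s` about `q + s • v`; expand the square.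
  -- Letting `s` tend to `R` gives the sharp constant.
  have key : ∀ s, s₀ < s → s < R → 2 * s * inner ℝ v (w - q) ≤ ‖w - q‖ ^ 2 := by
    intro s hs hsR
    have h1 := (hprox.mem_nearestPoints_extend hM hv1 hs₀0 hs hsR (hyv ▸ hq)).2 w hw
    have h2 : ‖q - (q + s • v)‖ = s := by
      rw [norm_sub_rev, add_sub_cancel_left, norm_smul, hv1, Real.norm_of_nonneg (by linarith),
        mul_one]
    rw [h2] at h1
    have h3 : ‖w - (q + s • v)‖ ^ 2 = ‖w - q‖ ^ 2 - 2 * (s * inner ℝ v (w - q)) + s ^ 2 := by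
      rw [← sub_sub, norm_sub_sq_real, inner_smul_right, norm_smul, hv1,
        Real.norm_of_nonneg (by linarith), real_inner_comm, mul_one]
    have h4 : s ^ 2 ≤ ‖w - (q + s • v)‖ ^ 2 := pow_le_pow_left₀ (by linarith) h1 2
    linarith
  have hlim : 2 * R * inner ℝ v (w - q) ≤ ‖w - q‖ ^ 2 := by
    have ht : Filter.Tendsto (fun s : ℝ => 2 * s * inner ℝ v (w - q)) (nhdsWithin R (Set.Iio R))
        (nhds (2 * R * inner ℝ v (w - q))) :=
      (Continuous.tendsto (by fun_prop) R).mono_left nhdsWithin_le_nhds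
    refine le_of_tendsto ht ?_
    filter_upwards [Ioo_mem_nhdsLT hyR] with s hs
    exact key s hs.1 hs.2
  rw [hvy, inner_smul_left]
  calc s₀ * inner ℝ v (w - q) = s₀ / (2 * R) * (2 * R * inner ℝ v (w - q)) := by field_simp
    _ ≤ _ := by gcongr

/-- The nearest-point projection onto a proximally smooth set is Lipschitz on tubes. -/
theorem IsProximallySmooth.norm_sub_le [FiniteDimensional ℝ E] {R : ℝ} {M : Set E} (hR : 0 < R)
    (hM : IsCompact M) (hprox : IsProximallySmooth R M) {y₁ y₂ q₁ q₂ : E} {r₁ r₂ : ℝ}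
    (h₁ : q₁ ∈ nearestPoints M y₁) (h₂ : q₂ ∈ nearestPoints M y₂) (hr₁ : ‖y₁ - q₁‖ ≤ r₁)
    (hr₂ : ‖y₂ - q₂‖ ≤ r₂) (hr₁R : r₁ < R) (hr₂R : r₂ < R) :
    (1 - (r₁ + r₂) / (2 * R)) * ‖q₁ - q₂‖ ≤ ‖y₁ - y₂‖ := by
  have e₁ := hprox.inner_le hR hM h₁ (hr₁.trans_lt hr₁R) h₂.1
  have e₂ := hprox.inner_le hR hM h₂ (hr₂.trans_lt hr₂R) h₁.1
  rw [norm_sub_rev q₂ q₁] at e₁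
  have f₁ : ‖y₁ - q₁‖ / (2 * R) * ‖q₁ - q₂‖ ^ 2 ≤ r₁ / (2 * R) * ‖q₁ - q₂‖ ^ 2 := by gcongr
  have f₂ : ‖y₂ - q₂‖ / (2 * R) * ‖q₁ - q₂‖ ^ 2 ≤ r₂ / (2 * R) * ‖q₁ - q₂‖ ^ 2 := by gcongr
  -- Adding the two normal inequalities leaves a monotonicity estimate, finished by Cauchy–Schwarz.
  have hid : inner ℝ (y₁ - q₁) (q₂ - q₁) + inner ℝ (y₂ - q₂) (q₁ - q₂)
      = ‖q₁ - q₂‖ ^ 2 - inner ℝ (y₁ - y₂) (q₁ - q₂) := by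
    rw [← real_inner_self_eq_norm_sq, ← neg_sub q₁ q₂, inner_neg_right, ← inner_neg_left,
      ← inner_add_left, ← inner_sub_left]
    congr 1
    abel
  have hcs := real_inner_le_norm (y₁ - y₂) (q₁ - q₂)
  have hmain : (1 - (r₁ + r₂) / (2 * R)) * ‖q₁ - q₂‖ * ‖q₁ - q₂‖ ≤ ‖y₁ - y₂‖ * ‖q₁ - q₂‖ := by
    rw [add_div]
    nlinarith
  rcases (norm_nonneg (q₁ - q₂)).eq_or_lt with h0 | h0
  · rw [← h0, mul_zero]; exact norm_nonneg _
  · exact le_of_mul_le_mul_right hmain h0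

end ProximalSmoothness

/-! ### Normal vectors to a smooth submanifold -/

section Normals

variable {E : Type*} [NormedAddCommGroup E] [InnerProductSpace ℝ E]

/-- First-order optimality: along any curve in `M` through `q`, the squared distance to `y` has a
local minimum at parameter `0`. -/
theorem inner_sub_eq_zero_of_mem_tangentSpace {M : Set E} {y q : E} (hq : q ∈ nearestPoints M y)
    {u : E} (hu : u ∈ tangentSpace M q) : inner ℝ (y - q) u = 0 := by
  induction hu using Submodule.span_induction with
  | mem u hu =>
    obtain ⟨c, hc0, hcM, hc⟩ := hu
    have hd : HasDerivAt (fun s => ‖c s - y‖ ^ 2) (2 * inner ℝ (c 0 - y) u) 0 :=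
      (hc.sub_const y).norm_sq
    have hmin : IsLocalMin (fun s => ‖c s - y‖ ^ 2) 0 := by
      filter_upwards [hcM] with s hs
      rw [hc0]
      exact pow_le_pow_left₀ (norm_nonneg _) (hq.2 _ hs) 2
    have h0 := hmin.hasDerivAt_eq_zero hd
    rw [hc0] at h0
    rw [← neg_sub, inner_neg_left]
    linarith
  | zero => simp
  | add u w _ _ hu hw => rw [inner_add_right, hu, hw, add_zero]
  | smul a u _ hu => rw [inner_smul_right, hu, mul_zero]

/-- Second order Taylor estimate, in a neighborhood of the point of expansion. -/
theorem _root_.ContDiffAt.exists_norm_sub_sub_fderiv_le {F : Type*} [NormedAddCommGroup F]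
    [NormedSpace ℝ F] {h : E → F} {x : E} (hh : ContDiffAt ℝ 2 h x) :
    ∃ K : ℝ, 0 ≤ K ∧ ∀ᶠ w in nhds x, ‖h w - h x - fderiv ℝ h x (w - x)‖ ≤ K * ‖w - x‖ ^ 2 := by
  obtain ⟨K, t, ht, hK⟩ := (hh.fderiv_right (m := 1) (by norm_num)).exists_lipschitzOnWith
  have hdiff : ∀ᶠ w in nhds x, DifferentiableAt ℝ h w := by
    filter_upwards [hh.eventually (by simp)] with w hw
    exact hw.differentiableAt (by simp)
  obtain ⟨r, hr, hball⟩ := Metric.eventually_nhds_iff_ball.1 (hdiff.and ht)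
  refine ⟨K, K.2, ?_⟩
  filter_upwards [Metric.ball_mem_nhds x hr] with w hw
  have hsub : Metric.closedBall x ‖w - x‖ ⊆ Metric.ball x r :=
    Metric.closedBall_subset_ball (by simpa [dist_eq_norm] using hw)
  have := (convex_closedBall x ‖w - x‖).norm_image_sub_le_of_norm_fderiv_le' (𝕜 := ℝ) (f := h)
    (φ := fderiv ℝ h x) (C := K * ‖w - x‖) (x := x) (y := w)
    (fun z hz => (hball z (hsub hz)).1)
    (fun z hz => by
      have h1 := hK.norm_sub_le (hball z (hsub hz)).2 (mem_of_mem_nhds ht)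
      refine h1.trans ?_
      gcongr
      simpa [dist_eq_norm] using hz)
    (Metric.mem_closedBall_self (norm_nonneg _)) (by simp [dist_eq_norm])
  exact this.trans_eq (by ring)

variable [FiniteDimensional ℝ E]

/-- Kernel vectors of a local defining submersion are tangent vectors. -/
theorem mem_tangentSpace_of_fderiv_eq_zero {F : Type*} [NormedAddCommGroup F] [NormedSpace ℝ F]
    [FiniteDimensional ℝ F] {M U : Set E} {x : E} (hU : U ∈ nhds x) {h : E → F} (hx : h x = 0)
    (hM : ∀ y ∈ U, y ∈ M ↔ h y = 0) (hh : HasStrictFDerivAt h (fderiv ℝ h x) x)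
    (hsurj : Function.Surjective (fderiv ℝ h x)) {u : E} (hu : fderiv ℝ h x u = 0) :
    u ∈ tangentSpace M x := by
  have hrange : (fderiv ℝ h x).range = ⊤ := LinearMap.range_eq_top.2 hsurj
  let u' : (fderiv ℝ h x).ker := ⟨u, hu⟩
  -- The implicit function parametrizes the fiber of `h` through `x` by the kernel, with derivative
  -- the inclusion, so `s ↦ g (s • u')` is a curve in `M` with velocity `u`.
  let g := hh.implicitFunction h (fderiv ℝ h x) hrange (h x)
  have hlin : HasDerivAt (fun s : ℝ => s • u') u' 0 := by
    simpa using (hasDerivAt_id (0 : ℝ)).smul_const u'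
  have hg : HasFDerivAt g (fderiv ℝ h x).ker.subtypeL ((0 : ℝ) • u') := by
    rw [zero_smul]
    exact (hh.to_implicitFunction hrange).hasFDerivAt
  have hd : HasDerivAt (g ∘ fun s : ℝ => s • u') u 0 :=
    HasFDerivAt.comp_hasDerivAt (f := fun s : ℝ => s • u') (0 : ℝ) hg hlin
  have hg0 : g ((0 : ℝ) • u') = x := by
    rw [zero_smul]; exact hh.implicitFunction_apply_image hrange
  refine Submodule.subset_span ⟨fun s => g (s • u'), hg0, ?_, hd⟩
  have hUe : ∀ᶠ s in nhds (0 : ℝ), g (s • u') ∈ U :=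
    hd.continuousAt.eventually (by rw [Function.comp_apply, hg0]; exact hU)
  have hlim : Filter.Tendsto (fun s : ℝ => (h x, s • u')) (nhds 0) (nhds (h x, 0)) := by
    refine Continuous.tendsto' (by fun_prop) _ _ (by simp)
  filter_upwards [hUe, hlim.eventually (hh.map_implicitFunction_eq hrange)] with s hs hs'
  exact (hM _ hs).2 (hs'.trans hx)

/-- Vectors orthogonal to the tangent space satisfy the proximal normal inequality locally. -/
theorem IsSmoothSubmanifold.exists_inner_le {p : ℕ} {M : Set E} (hM : IsSmoothSubmanifold p M)
    {x : E} (hx : x ∈ M) {v : E} (hv : ∀ u ∈ tangentSpace M x, inner ℝ v u = 0) :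
    ∃ C : ℝ, 0 ≤ C ∧ ∀ w ∈ M, inner ℝ v (w - x) ≤ C * ‖w - x‖ ^ 2 := by
  obtain ⟨k, -, hM⟩ := hM
  obtain ⟨U, hUo, hxU, h, hh, hUM, hsurj⟩ := hM x hx
  have hU : U ∈ nhds x := hUo.mem_nhds hxU
  have hx0 : h x = 0 := (hUM x hxU).1 hx
  have hcd : ContDiffAt ℝ ∞ h x := hh.contDiffAt hU
  have hst := hcd.hasStrictFDerivAt (by simp)
  -- Normals lie in the range of the adjoint of the differential. Pairing one with `w - x` tests
  -- `fderiv ℝ h x (w - x)`, which is of second order since `h` vanishes at both points.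
  have hmem : v ∈ (fderiv ℝ h x : E →ₗ[ℝ] EuclideanSpace ℝ (Fin k)).kerᗮ :=
    (Submodule.mem_orthogonal' _ _).2 fun u hu =>
      hv u (mem_tangentSpace_of_fderiv_eq_zero hU hx0 hUM hst hsurj hu)
  rw [LinearMap.orthogonal_ker] at hmem
  obtain ⟨l, rfl⟩ := hmem
  set v := LinearMap.adjoint (fderiv ℝ h x : E →ₗ[ℝ] EuclideanSpace ℝ (Fin k)) l
  obtain ⟨K, hK0, hK⟩ := (hcd.of_le (m := 2)
    ENat.LEInfty.out).exists_norm_sub_sub_fderiv_le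
  obtain ⟨r, hr, hball⟩ := Metric.eventually_nhds_iff_ball.1 (hK.and hU)
  -- The first constant serves inside the ball of radius `r`, the second outside, where a linear
  -- bound is already quadratic.
  refine ⟨max (‖l‖ * K) (‖v‖ / r), le_max_of_le_left (by positivity), fun w hw => ?_⟩
  by_cases hwr : w ∈ Metric.ball x r
  · obtain ⟨h1, h2⟩ := hball w hwr
    rw [(hUM w h2).1 hw, hx0, sub_zero, zero_sub, norm_neg] at h1
    calc inner ℝ v (w - x) = inner ℝ l (fderiv ℝ h x (w - x)) :=
          LinearMap.adjoint_inner_left _ _ _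
      _ ≤ ‖l‖ * ‖fderiv ℝ h x (w - x)‖ := real_inner_le_norm _ _
      _ ≤ ‖l‖ * (K * ‖w - x‖ ^ 2) := by gcongr
      _ = ‖l‖ * K * ‖w - x‖ ^ 2 := by ring
      _ ≤ _ := by gcongr; exact le_max_left _ _
  · have hwr' : r ≤ ‖w - x‖ := by simpa [dist_eq_norm] using hwr
    calc inner ℝ v (w - x) ≤ ‖v‖ * ‖w - x‖ := real_inner_le_norm _ _
      _ = ‖v‖ / r * (r * ‖w - x‖) := by field_simp
      _ ≤ ‖v‖ / r * (‖w - x‖ * ‖w - x‖) := by gcongr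
      _ = ‖v‖ / r * ‖w - x‖ ^ 2 := by ring
      _ ≤ _ := by gcongr; exact le_max_right _ _

/-- The normal inequality for all vectors orthogonal to the tangent space of a proximally smooth
compact submanifold. -/
theorem IsSmoothSubmanifold.inner_normal_le {p : ℕ} {M : Set E} (hM : IsSmoothSubmanifold p M)
    (hMc : IsCompact M) {R : ℝ} (hR : 0 < R) (hprox : IsProximallySmooth R M) {x : E} (hx : x ∈ M)
    {v : E} (hv : ∀ u ∈ tangentSpace M x, inner ℝ v u = 0) {w : E} (hw : w ∈ M) :
    inner ℝ v (w - x) ≤ ‖v‖ / (2 * R) * ‖w - x‖ ^ 2 := by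
  obtain ⟨C, hC, hCle⟩ := hM.exists_inner_le hx hv
  -- For small `s` the non-uniform constant `C` suffices to make `x` a nearest point of `x + s • v`.
  -- The proximal inequality is homogeneous in `v`, so `s` cancels and `C` disappears.
  set s := min (1 / (2 * (C + 1))) (R / (2 * (‖v‖ + 1))) with hs
  have hs0 : 0 < s := by positivity
  have hsC : s * (2 * C) ≤ 1 := by
    calc s * (2 * C) ≤ 1 / (2 * (C + 1)) * (2 * (C + 1)) := by
          gcongr
          · exact min_le_left _ _
          · linarith
      _ = 1 := by field_simp
  have hsR : s * ‖v‖ < R := by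
    calc s * ‖v‖ ≤ R / (2 * (‖v‖ + 1)) * (‖v‖ + 1) := by
          gcongr
          · exact min_le_right _ _
          · linarith
      _ = R / 2 := by field_simp
      _ < R := by linarith
  have hnear : x ∈ nearestPoints M (x + s • v) := by
    refine ⟨hx, fun w hw => ?_⟩
    refine (abs_le_of_sq_le_sq' ?_ (norm_nonneg _)).2
    have e : w - (x + s • v) = (w - x) - s • v := by abel
    have e' : x - (x + s • v) = -(s • v) := by abel
    rw [e, e', norm_neg, norm_sub_sq_real, inner_smul_right, real_inner_comm]
    have h1 := mul_le_mul_of_nonneg_left (hCle w hw) hs0.le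
    have h2 := mul_le_mul_of_nonneg_right hsC (sq_nonneg ‖w - x‖)
    linarith
  have hsub : x + s • v - x = s • v := by abel
  have hns : ‖s • v‖ = s * ‖v‖ := by rw [norm_smul, Real.norm_of_nonneg hs0.le]
  have := hprox.inner_le hR hMc hnear (by rwa [hsub, hns]) hw
  rw [hsub, hns, inner_smul_left] at this
  refine le_of_mul_le_mul_left ?_ hs0
  calc s * inner ℝ v (w - x) ≤ s * ‖v‖ / (2 * R) * ‖w - x‖ ^ 2 := this
    _ = _ := by ring

end Normals

/-! ### Contraction of gossip by the second singular value -/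

section Mixing

/-- A linear map `T` contracts the orthogonal complement of a fixed vector of `T† T` by the
second singular value, if that singular value is less than one. -/
theorem norm_apply_le_singularValues_one {F : Type*} [NormedAddCommGroup F]
    [InnerProductSpace ℝ F] [FiniteDimensional ℝ F] (T : F →ₗ[ℝ] F) {e : F} (he : e ≠ 0)
    (hTe : LinearMap.adjoint T (T e) = e) (hT : T.singularValues 1 < 1) {u : F}
    (hu : inner ℝ e u = 0) : ‖T u‖ ≤ T.singularValues 1 * ‖u‖ := by
  obtain ⟨m, hm⟩ : ∃ m, Module.finrank ℝ F = m + 1 := by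
    have : Nontrivial F := ⟨e, 0, he⟩
    exact Nat.exists_eq_succ_of_ne_zero Module.finrank_pos.ne'
  set S := T.isSymmetric_adjoint_comp_self
  set b := S.eigenvectorBasis hm
  set lam := S.eigenvalues hm
  have hlam : ∀ i, i ≠ 0 → lam i ≤ T.singularValues 1 ^ 2 := by
    intro i hi
    refine (T.sq_singularValues_fin hm i).symm.trans_le ?_
    refine pow_le_pow_left₀ (T.singularValues_nonneg _) (T.singularValues_antitone ?_) 2
    have := Fin.val_ne_zero_iff.2 hi
    omega
  have hσ0 := T.singularValues_nonneg 1
  have hrepr : ∀ x i, inner ℝ (b i) (LinearMap.adjoint T (T x)) = lam i * inner ℝ (b i) x := by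
    intro x i
    have := S.eigenvectorBasis_apply_self_apply hm x i
    simpa [OrthonormalBasis.repr_apply_apply] using this
  have hbe : ∀ i, i ≠ 0 → inner ℝ (b i) e = 0 := by
    intro i hi
    have h1 := hrepr e i
    rw [hTe] at h1
    have h2 : lam i < 1 := (hlam i hi).trans_lt (by nlinarith)
    have h3 : (1 - lam i) * inner ℝ (b i) e = 0 := by linarith
    exact (mul_eq_zero.1 h3).resolve_left (by linarith)
  -- Eigenvalues of `T† T` other than the first are below `1`, so the fixed vector `e` spans the top
  -- eigenline and `u` has no component there.
  have he0 : e = (inner ℝ (b 0) e : ℝ) • b 0 := by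
    conv_lhs => rw [← b.sum_repr' e]
    exact Finset.sum_eq_single 0 (fun i _ hi => by rw [hbe i hi, zero_smul]) (by simp)
  have hbu : inner ℝ (b 0) u = 0 := by
    rw [he0, inner_smul_left] at hu
    refine (mul_eq_zero.1 hu).resolve_left fun h0 => he ?_
    rw [he0, show inner ℝ (b 0) e = 0 by simpa using h0, zero_smul]
  refine (abs_le_of_sq_le_sq' ?_ (by positivity)).2
  calc ‖T u‖ ^ 2 = inner ℝ u (LinearMap.adjoint T (T u)) := by
        rw [LinearMap.adjoint_inner_right, real_inner_self_eq_norm_sq]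
    _ = ∑ i, lam i * inner ℝ (b i) u ^ 2 := by
        rw [← b.sum_inner_mul_inner u]
        refine Finset.sum_congr rfl fun i _ => ?_
        rw [hrepr, real_inner_comm]
        ring
    _ ≤ ∑ i, T.singularValues 1 ^ 2 * inner ℝ (b i) u ^ 2 := by
        refine Finset.sum_le_sum fun i _ => ?_
        rcases eq_or_ne i 0 with rfl | hi
        · simp [hbu]
        · exact mul_le_mul_of_nonneg_right (hlam i hi) (sq_nonneg _)
    _ = (T.singularValues 1 * ‖u‖) ^ 2 := by
        rw [← Finset.mul_sum, mul_pow, ← b.sum_sq_norm_inner_right u]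
        simp

variable {n : ℕ} {G : SimpleGraph (Fin n)} {W : Matrix (Fin n) (Fin n) ℝ}

theorem NetworkAssumption.pow_mem (hW : NetworkAssumption G W) (t : ℕ) :
    W ^ t ∈ doublyStochastic ℝ (Fin n) :=
  _root_.pow_mem hW.doubly_stochastic t

/-- The all-ones vector is fixed by `W` and by its adjoint, which is `W` itself; `u` is orthogonal
to it. -/
theorem NetworkAssumption.sum_sq_mulVec_le (hW : NetworkAssumption G W) {u : Fin n → ℝ}
    (hu : ∑ i, u i = 0) :
    ∑ i, (W.mulVec u) i ^ 2 ≤ sigmaTwo W ^ 2 * ∑ i, u i ^ 2 := by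
  obtain ⟨i₀⟩ := hW.connected.nonempty
  have hone : W.mulVec 1 = 1 := mulVec_one_of_mem_doublyStochastic hW.doubly_stochastic
  have hadj : LinearMap.adjoint (Matrix.toEuclideanLin W) = Matrix.toEuclideanLin W := by
    rw [← Matrix.toEuclideanLin_conjTranspose_eq_adjoint, Matrix.conjTranspose_eq_transpose_of_trivial,
      hW.symm.eq]
  have hT1 : Matrix.toEuclideanLin W (WithLp.toLp 2 1) = WithLp.toLp 2 1 := by
    rw [Matrix.toLpLin_toLp, Matrix.toLin'_apply, hone]
  have := norm_apply_le_singularValues_one (Matrix.toEuclideanLin W)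
    (e := WithLp.toLp 2 1) (u := WithLp.toLp 2 u)
    (by
      intro h
      have := congrFun (congrArg WithLp.ofLp h) i₀
      simp at this)
    (by rw [hadj, hT1, hT1]) hW.sigmaTwo_lt_one
    (by simpa [PiLp.inner_apply] using hu)
  have := pow_le_pow_left₀ (norm_nonneg _) this 2
  rw [mul_pow, EuclideanSpace.norm_sq_eq, EuclideanSpace.norm_sq_eq] at this
  simpa [sigmaTwo] using this

theorem NetworkAssumption.sum_sq_pow_mulVec_le (hW : NetworkAssumption G W) (t : ℕ)
    {u : Fin n → ℝ} (hu : ∑ i, u i = 0) :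
    ∑ i, ((W ^ t).mulVec u) i ^ 2 ≤ (sigmaTwo W ^ t) ^ 2 * ∑ i, u i ^ 2 := by
  induction t with
  | zero => simp
  | succ t ih =>
    have h0 : ∑ i, ((W ^ t).mulVec u) i = 0 := by
      rw [sum_mulVec_of_mem_doublyStochastic (hW.pow_mem t), hu]
    rw [pow_succ' W, ← Matrix.mulVec_mulVec]
    calc _ ≤ sigmaTwo W ^ 2 * ∑ i, ((W ^ t).mulVec u) i ^ 2 := hW.sum_sq_mulVec_le h0
      _ ≤ sigmaTwo W ^ 2 * ((sigmaTwo W ^ t) ^ 2 * ∑ i, u i ^ 2) := by gcongr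
      _ = _ := by ring

/-- Gossip contracts the consensus error of vector-valued states. -/
theorem NetworkAssumption.sum_norm_sq_pow_sub_mean_le {E : Type*} [NormedAddCommGroup E]
    [InnerProductSpace ℝ E] [FiniteDimensional ℝ E] (hW : NetworkAssumption G W) (t : ℕ)
    (x : Fin n → E) :
    ∑ i, ‖∑ j, (W ^ t) i j • x j - mean x‖ ^ 2 ≤
      (sigmaTwo W ^ t) ^ 2 * ∑ i, ‖x i - mean x‖ ^ 2 := by
  obtain ⟨i₀⟩ := hW.connected.nonempty
  have hn : (n : ℝ) ≠ 0 := by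
    have := Fin.pos i₀
    positivity
  set b := stdOrthonormalBasis ℝ E
  have hsum : ∑ i, (x i - mean x) = 0 := by
    rw [Finset.sum_sub_distrib, mean, Finset.sum_const, Finset.card_univ, Fintype.card_fin,
      ← Nat.cast_smul_eq_nsmul ℝ, smul_smul, mul_inv_cancel₀ hn, one_smul, sub_self]
  have hrow : ∀ i, ∑ j, (W ^ t) i j • x j - mean x = ∑ j, (W ^ t) i j • (x j - mean x) := by
    intro i
    simp_rw [smul_sub]
    rw [Finset.sum_sub_distrib, ← Finset.sum_smul, sum_row_of_mem_doublyStochastic (hW.pow_mem t),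
      one_smul]
  simp_rw [hrow, ← b.sum_sq_norm_inner_right]
  rw [Finset.sum_comm, Finset.sum_comm (s := Finset.univ (α := Fin n)), Finset.mul_sum]
  refine Finset.sum_le_sum fun c _ => ?_
  have := hW.sum_sq_pow_mulVec_le t (u := fun i => inner ℝ (b c) (x i - mean x))
    (by rw [← inner_sum, hsum, inner_zero_right])
  simpa [inner_sum, inner_smul_right, Matrix.mulVec, dotProduct] using this

theorem pow_le_of_ceil_logb_le {σ a : ℝ} (hσ : 0 < σ) (hσ1 : σ < 1) (ha : 0 < a) {t : ℕ}
    (ht : ⌈Real.logb σ a⌉ ≤ (t : ℤ)) : σ ^ t ≤ a := by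
  have h1 : Real.logb σ a ≤ t := by exact_mod_cast Int.ceil_le.1 ht
  have := (Real.logb_le_iff_le_rpow_of_base_lt_one hσ hσ1 ha).1 h1
  simpa using this

end Mixing

/-! ### Analysis of a single projected gossip step -/

section Step

variable {E : Type*} [NormedAddCommGroup E] [InnerProductSpace ℝ E] {n : ℕ}

theorem mean_eq_sum (x : Fin n → E) : mean x = ∑ i, (n : ℝ)⁻¹ • x i := by
  rw [mean, Finset.smul_sum]

theorem sum_inv_card (hn : 0 < n) : ∑ _i : Fin n, (n : ℝ)⁻¹ = 1 := by
  have : (n : ℝ) ≠ 0 := by positivity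
  simp [this]

theorem norm_sum_smul_sub_le {w : Fin n → ℝ} (hw : ∀ i, 0 ≤ w i) (hw1 : ∑ i, w i = 1)
    {x : Fin n → E} {c : E} {D : ℝ} (hD : ∀ i, ‖x i - c‖ ≤ D) : ‖∑ i, w i • x i - c‖ ≤ D := by
  have e : ∑ i, w i • x i - c = ∑ i, w i • (x i - c) := by
    simp_rw [smul_sub]
    rw [Finset.sum_sub_distrib, ← Finset.sum_smul, hw1, one_smul]
  rw [e]
  calc ‖∑ i, w i • (x i - c)‖ ≤ ∑ i, w i * D := by
        refine norm_sum_le_of_le _ fun i _ => ?_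
        rw [norm_smul, Real.norm_of_nonneg (hw i)]
        exact mul_le_mul_of_nonneg_left (hD i) (hw i)
    _ = D := by rw [← Finset.sum_mul, hw1, one_mul]

theorem norm_mean_sub_le (hn : 0 < n) {x : Fin n → E} {c : E} {D : ℝ} (hD : ∀ i, ‖x i - c‖ ≤ D) :
    ‖mean x - c‖ ≤ D := by
  rw [mean_eq_sum]
  exact norm_sum_smul_sub_le (fun _ => by positivity) (sum_inv_card hn) hD

theorem norm_mean_sub_mean_le (hn : 0 < n) {u v : Fin n → E} {D : ℝ} (h : ∀ i, ‖u i - v i‖ ≤ D) :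
    ‖mean u - mean v‖ ≤ D := by
  have e : mean u - mean v = mean (fun i => u i - v i) := by
    simp only [mean, Finset.sum_sub_distrib, smul_sub]
  rw [e]
  simpa using norm_mean_sub_le hn (x := fun i => u i - v i) (c := (0 : E)) (by simpa using h)

theorem sum_norm_sub_mean_sq_le (hn : 0 < n) (x : Fin n → E) (c : E) :
    ∑ i, ‖x i - mean x‖ ^ 2 ≤ ∑ i, ‖x i - c‖ ^ 2 := by
  have hn' : (n : ℝ) ≠ 0 := by positivity
  have hsum : ∑ i, (x i - mean x) = 0 := by
    rw [Finset.sum_sub_distrib, mean, Finset.sum_const, Finset.card_univ, Fintype.card_fin,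
      ← Nat.cast_smul_eq_nsmul ℝ, smul_smul, mul_inv_cancel₀ hn', one_smul, sub_self]
  have h : ∀ i, ‖x i - c‖ ^ 2 = ‖x i - mean x‖ ^ 2 + 2 * inner ℝ (x i - mean x) (mean x - c)
      + ‖mean x - c‖ ^ 2 := by
    intro i
    rw [← norm_add_sq_real, sub_add_sub_cancel]
  simp_rw [h]
  rw [Finset.sum_add_distrib, Finset.sum_add_distrib, ← Finset.mul_sum, ← sum_inner, hsum,
    inner_zero_left]
  have : 0 ≤ ∑ _i : Fin n, ‖mean x - c‖ ^ 2 := by positivity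
  linarith

theorem inner_sum_smul_sub_le {w : Fin n → ℝ} (hw : ∀ i, 0 ≤ w i) (hw1 : ∑ i, w i = 1)
    {x : Fin n → E} {q v : E} {b : ℝ} (h : ∀ i, inner ℝ v (x i - q) ≤ b) :
    inner ℝ v (∑ i, w i • x i - q) ≤ b := by
  have e : ∑ i, w i • x i - q = ∑ i, w i • (x i - q) := by
    simp_rw [smul_sub]
    rw [Finset.sum_sub_distrib, ← Finset.sum_smul, hw1, one_smul]
  rw [e, inner_sum]
  calc ∑ i, inner ℝ v (w i • (x i - q)) ≤ ∑ i, w i * b := by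
        refine Finset.sum_le_sum fun i _ => ?_
        rw [inner_smul_right]
        exact mul_le_mul_of_nonneg_left (h i) (hw i)
    _ = b := by rw [← Finset.sum_mul, hw1, one_mul]

variable {M : Set E} {γ : ℝ}

/-- One step of projected gossip: `x'` results from `x` by averaging with the weights `A`,
subtracting the small perturbation `g` and projecting onto `M`; `q` is the induced mean of `x`. -/
structure IsProjectedStep (M : Set E) (γ : ℝ) (A : Matrix (Fin n) (Fin n) ℝ)
    (x : Fin n → E) (q : E) (g x' : Fin n → E) : Prop where
  stochastic : A ∈ doublyStochastic ℝ (Fin n)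
  mem : ∀ i, x i ∈ M
  nearest : q ∈ nearestPoints M (mean x)
  near : ∀ i, ‖x i - q‖ ≤ γ / 2
  perturb : ∀ i, ‖g i‖ ≤ γ / 24
  step : ∀ i, x' i ∈ nearestPoints M (∑ j, A i j • x j - g i)

/-- The center `q` competes in the projection: `13/24 = 1/2 + 1/24`. -/
theorem IsProjectedStep.norm_sub_le {A : Matrix (Fin n) (Fin n) ℝ} {x g x' : Fin n → E} {q : E}
    (h : IsProjectedStep M γ A x q g x') (i : Fin n) :
    ‖∑ j, A i j • x j - g i - x' i‖ ≤ 13 / 24 * γ := by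
  rw [norm_sub_rev]
  refine ((h.step i).2 q h.nearest.1).trans ?_
  have e : q - (∑ j, A i j • x j - g i) = -(∑ j, A i j • x j - q) + g i := by abel
  rw [e]
  refine (norm_add_le _ _).trans ?_
  rw [norm_neg]
  have := norm_sum_smul_sub_le (fun j => nonneg_of_mem_doublyStochastic h.stochastic (i := i))
    (sum_row_of_mem_doublyStochastic h.stochastic i) h.near
  linarith [h.perturb i]

variable [FiniteDimensional ℝ E]

theorem norm_tangentProj_apply_le (x v : E) : ‖tangentProj M x v‖ ≤ ‖v‖ :=
  Submodule.norm_starProjection_apply_le _ _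

/-- The displacement caused by projecting a tangential perturbation of a weighted average of nearby
points of `M` is of second order. -/
theorem IsProximallySmooth.norm_sub_nearest_le (hγ : 0 < γ) (hM : IsCompact M)
    (hprox : IsProximallySmooth (2 * γ) M) {LP : ℝ} (hLP : 0 ≤ LP)
    (hMLP : ∀ x ∈ M, ∀ y ∈ M, ‖tangentProj M x - tangentProj M y‖ ≤ LP * ‖x - y‖)
    {w : Fin n → ℝ} (hw : ∀ i, 0 ≤ w i) (hw1 : ∑ i, w i = 1) {x : Fin n → E} (hx : ∀ i, x i ∈ M)
    {i : Fin n} {α LG D : ℝ} (hα : 0 ≤ α) {v q : E} (hv : ‖v‖ ≤ LG)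
    (hq : q ∈ nearestPoints M (∑ j, w j • x j - α • tangentProj M (x i) v))
    (hdist : ‖∑ j, w j • x j - α • tangentProj M (x i) v - q‖ < 2 * γ)
    (hD : ∀ j, ‖x j - q‖ ≤ D) :
    ‖∑ j, w j • x j - α • tangentProj M (x i) v - q‖ ≤ D ^ 2 / (4 * γ) + α * (LP * D * LG) := by
  set s := ∑ j, w j • x j with hs
  set u := s - α • tangentProj M (x i) v - q with hu
  have h0 : inner ℝ u (tangentProj M q v) = 0 :=
    inner_sub_eq_zero_of_mem_tangentSpace hq (Submodule.starProjection_apply_mem _ _)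
  have h1 : inner ℝ u (s - q) ≤ ‖u‖ / (4 * γ) * D ^ 2 := by
    refine inner_sum_smul_sub_le hw hw1 fun j => ?_
    calc inner ℝ u (x j - q) ≤ ‖u‖ / (2 * (2 * γ)) * ‖x j - q‖ ^ 2 :=
          hprox.inner_le (by positivity) hM hq hdist (hx j)
      _ ≤ ‖u‖ / (4 * γ) * D ^ 2 := by
          rw [← mul_assoc, show (2 : ℝ) * 2 = 4 by norm_num]
          gcongr
          exact hD j
  -- The residual `u` is normal at `q`, so only the difference of the tangent projections at `q` and
  -- `x i` contributes.
  have h2 : -inner ℝ u (tangentProj M (x i) v) ≤ ‖u‖ * (LP * D * LG) := by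
    have e : -inner ℝ u (tangentProj M (x i) v)
        = inner ℝ u ((tangentProj M q - tangentProj M (x i)) v) := by
      rw [sub_apply, inner_sub_right, h0, zero_sub]
    rw [e]
    refine (real_inner_le_norm _ _).trans ?_
    gcongr
    refine (ContinuousLinearMap.le_opNorm _ _).trans ?_
    have := (hMLP q hq.1 (x i) (hx i)).trans
      (mul_le_mul_of_nonneg_left ((norm_sub_rev _ _).trans_le (hD i)) hLP)
    exact mul_le_mul this hv (norm_nonneg _) ((norm_nonneg _).trans this)
  have h3 : ‖u‖ * ‖u‖ = inner ℝ u (s - q) + α * -inner ℝ u (tangentProj M (x i) v) := by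
    have e : inner ℝ u u = inner ℝ u ((s - q) - α • tangentProj M (x i) v) := by
      congr 1
      rw [hu]; abel
    rw [← real_inner_self_eq_norm_mul_norm, e, inner_sub_right, inner_smul_right]
    ring
  have h4 : ‖u‖ * ‖u‖ ≤ (D ^ 2 / (4 * γ) + α * (LP * D * LG)) * ‖u‖ := by
    rw [h3]
    calc _ ≤ ‖u‖ / (4 * γ) * D ^ 2 + α * (‖u‖ * (LP * D * LG)) := by gcongr
      _ = _ := by ring
  have hD0 : 0 ≤ D := (norm_nonneg _).trans (hD i)
  have hLG : 0 ≤ LG := (norm_nonneg _).trans hv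
  rcases (norm_nonneg u).eq_or_lt with hz | hz
  · rw [← hz]; positivity
  · exact le_of_mul_le_mul_right h4 hz

theorem IsProximallySmooth.norm_mean_sub_nearest_le (hγ : 0 < γ) (hM : IsCompact M)
    (hprox : IsProximallySmooth (2 * γ) M) (hn : 0 < n) {x : Fin n → E} (hx : ∀ i, x i ∈ M)
    {D : ℝ} {q : E} (hq : q ∈ nearestPoints M (mean x)) (hdist : ‖mean x - q‖ < 2 * γ)
    (hD : ∀ j, ‖x j - q‖ ≤ D) : ‖mean x - q‖ ≤ D ^ 2 / (4 * γ) := by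
  have h1 : inner ℝ (mean x - q) (mean x - q) ≤ ‖mean x - q‖ / (4 * γ) * D ^ 2 := by
    nth_rw 2 [mean_eq_sum]
    refine inner_sum_smul_sub_le (fun _ => by positivity) (sum_inv_card hn) fun j => ?_
    calc _ ≤ ‖mean x - q‖ / (2 * (2 * γ)) * ‖x j - q‖ ^ 2 :=
          hprox.inner_le (by positivity) hM hq hdist (hx j)
      _ ≤ ‖mean x - q‖ / (4 * γ) * D ^ 2 := by
          rw [← mul_assoc, show (2 : ℝ) * 2 = 4 by norm_num]
          gcongr
          exact hD j
  rw [real_inner_self_eq_norm_mul_norm] at h1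
  rcases (norm_nonneg (mean x - q)).eq_or_lt with hz | hz
  · rw [← hz]; positivity
  · refine le_of_mul_le_mul_right (h1.trans_eq ?_) hz
    ring

namespace IsProjectedStep

variable {A : Matrix (Fin n) (Fin n) ℝ} {x g x' : Fin n → E} {q : E}

/-- Both `x' i` and `q` are projections from tubes of radii `13/24 * γ` and `γ / 2`, on which the
projection has Lipschitz constant `96/71`. -/
theorem norm_sub_center_le (hγ : 0 < γ) (hM : IsCompact M) (hprox : IsProximallySmooth (2 * γ) M)
    (h : IsProjectedStep M γ A x q g x') (i : Fin n) :
    ‖x' i - q‖ ≤ 96 / 71 * (‖∑ j, A i j • x j - mean x‖ + ‖g i‖) := by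
  have := hprox.norm_sub_le (by positivity) hM (h.step i) h.nearest (h.norm_sub_le i)
    (norm_mean_sub_le (Fin.pos i) h.near) (by linarith) (by linarith)
  have e : 1 - (13 / 24 * γ + γ / 2) / (2 * (2 * γ)) = 71 / 96 := by
    field_simp
    norm_num
  rw [e, sub_right_comm] at this
  have := this.trans (_root_.norm_sub_le _ _)
  linarith

/-- Each `x' i` is within `96/71 * γ / 12 ≤ γ / 6` of `q`. Going from `x' i` through `q` and `mean
x'` to `q'` costs three such distances. -/
theorem near_next (hγ : 0 < γ) (hM : IsCompact M) (hprox : IsProximallySmooth (2 * γ) M)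
    (h : IsProjectedStep M γ A x q g x') (hmix : ∀ i, ‖∑ j, A i j • x j - mean x‖ ≤ γ / 24)
    {q' : E} (hq' : q' ∈ nearestPoints M (mean x')) (i : Fin n) : ‖x' i - q'‖ ≤ γ / 2 := by
  have h1 : ∀ i, ‖x' i - q‖ ≤ γ / 6 := fun i =>
    (h.norm_sub_center_le hγ hM hprox i).trans (by linarith [hmix i, h.perturb i])
  have h2 : ‖mean x' - q‖ ≤ γ / 6 := norm_mean_sub_le (Fin.pos i) h1
  have h3 := hq'.2 q h.nearest.1
  have h4 : ‖x' i - q'‖ ≤ ‖x' i - q‖ + ‖q - mean x'‖ + ‖mean x' - q'‖ := by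
    calc ‖x' i - q'‖ = ‖(x' i - q) + (q - mean x') + (mean x' - q')‖ := by congr 1; abel
      _ ≤ _ := norm_add₃_le
  rw [norm_sub_rev q' (mean x')] at h3
  rw [norm_sub_rev q (mean x')] at h3 h4
  linarith [h1 i]

/-- A Young inequality weighted heavily towards `β` keeps the factor `1.96` close to `(96/71) ^ 2`,
so that after mixing it is `0.49`, still below `1/2`. -/
theorem sum_norm_sq_next_le (hγ : 0 < γ) (hM : IsCompact M)
    (hprox : IsProximallySmooth (2 * γ) M) (h : IsProjectedStep M γ A x q g x') {β S : ℝ}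
    (hg : ∀ i, ‖g i‖ ≤ β) (hmix : ∑ i, ‖∑ j, A i j • x j - mean x‖ ^ 2 ≤ 1 / 4 * S) :
    ∑ i, ‖x' i - q‖ ^ 2 ≤ 49 / 100 * S + n * (32 * β ^ 2) := by
  have key : ∀ i, ‖x' i - q‖ ^ 2 ≤
      196 / 100 * ‖∑ j, A i j • x j - mean x‖ ^ 2 + 32 * β ^ 2 := by
    intro i
    set a := ‖∑ j, A i j • x j - mean x‖
    have h1 : ‖x' i - q‖ ^ 2 ≤ (96 / 71 * (a + β)) ^ 2 := by
      refine pow_le_pow_left₀ (norm_nonneg _) ?_ 2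
      exact (h.norm_sub_center_le hγ hM hprox i).trans (by gcongr; exact hg i)
    nlinarith [sq_nonneg (a - 16 * β), sq_nonneg a, sq_nonneg β]
  refine (Finset.sum_le_sum fun i _ => key i).trans ?_
  rw [Finset.sum_add_distrib, ← Finset.mul_sum, Finset.sum_const, Finset.card_univ,
    Fintype.card_fin, nsmul_eq_mul]
  linarith

/-- The induced means move along the average perturbation, up to a second-order error. -/
theorem norm_center_sub_le (hγ : 0 < γ) (hM : IsCompact M) (hprox : IsProximallySmooth (2 * γ) M)
    (hn : 0 < n) {LP : ℝ} (hLP : 0 ≤ LP)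
    (hMLP : ∀ x ∈ M, ∀ y ∈ M, ‖tangentProj M x - tangentProj M y‖ ≤ LP * ‖x - y‖)
    {α LG D : ℝ} (hα : 0 ≤ α) {v : Fin n → E} (hv : ∀ i, ‖v i‖ ≤ LG)
    (h : IsProjectedStep M γ A x q (fun i => α • tangentProj M (x i) (v i)) x') {q' : E}
    (hq' : q' ∈ nearestPoints M (mean x')) (hx' : ∀ i, ‖x' i - q'‖ ≤ γ / 2)
    (hD : ∀ i, ‖x i - q‖ ≤ D) (hD' : ∀ i, ‖x' i - q‖ ≤ D) :
    ‖q' - q + α • mean (fun i => tangentProj M (x i) (v i))‖ ≤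
      14 * D ^ 2 / (4 * γ) + 2 * α * LP * LG * D := by
  set g := fun i => α • tangentProj M (x i) (v i) with hg
  have hn' : (n : ℝ) ≠ 0 := by positivity
  have e1 : ‖mean x - q‖ ≤ D ^ 2 / (4 * γ) :=
    hprox.norm_mean_sub_nearest_le hγ hM hn h.mem h.nearest
      ((norm_mean_sub_le hn h.near).trans_lt (by linarith)) hD
  -- The old center `q` competes in the projection of `mean x'`; this puts every `x' i` within `3 *
  -- D` of `q'`.
  have hm' : ‖mean x' - q'‖ ≤ D := by
    rw [norm_sub_rev]
    refine (hq'.2 q h.nearest.1).trans ?_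
    rw [norm_sub_rev]
    exact norm_mean_sub_le hn hD'
  have e2 : ‖mean x' - q'‖ ≤ (3 * D) ^ 2 / (4 * γ) := by
    refine hprox.norm_mean_sub_nearest_le hγ hM hn (fun i => (h.step i).1) hq'
      ((norm_mean_sub_le hn hx').trans_lt (by linarith)) fun i => ?_
    have h4 : ‖x' i - q'‖ ≤ ‖x' i - q‖ + ‖q - mean x'‖ + ‖mean x' - q'‖ := by
      calc ‖x' i - q'‖ = ‖(x' i - q) + (q - mean x') + (mean x' - q')‖ := by congr 1; abel
        _ ≤ _ := norm_add₃_le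
    have := norm_mean_sub_le hn hD'
    rw [norm_sub_rev q (mean x')] at h4
    linarith [hD' i]
  have e3 : ∀ i, ‖x' i - (∑ j, A i j • x j - g i)‖ ≤
      (2 * D) ^ 2 / (4 * γ) + α * (LP * (2 * D) * LG) := by
    intro i
    rw [norm_sub_rev]
    refine hprox.norm_sub_nearest_le hγ hM hLP hMLP
      (fun j => nonneg_of_mem_doublyStochastic h.stochastic)
      (sum_row_of_mem_doublyStochastic h.stochastic i) h.mem hα (hv i) (h.step i)
      ((h.norm_sub_le i).trans_lt (by linarith)) fun j => ?_
    have := norm_sub_le_norm_sub_add_norm_sub (x j) q (x' i)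
    rw [norm_sub_rev q] at this
    linarith [hD j, hD' i]
  -- Unit column sums mean that gossip preserves the average, leaving only the mean projection
  -- residual.
  have e4 : mean x' - mean x + α • mean (fun i => tangentProj M (x i) (v i)) =
      mean (fun i => x' i - (∑ j, A i j • x j - g i)) := by
    have hcol : ∑ i, ∑ j, A i j • x j = ∑ j, x j := by
      rw [Finset.sum_comm]
      refine Finset.sum_congr rfl fun j _ => ?_
      rw [← Finset.sum_smul, sum_col_of_mem_doublyStochastic h.stochastic, one_smul]
    simp only [mean, Finset.sum_sub_distrib, hcol, hg, ← Finset.smul_sum, smul_sub]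
    rw [smul_comm α]
    abel
  have e5 : ‖mean x' - mean x + α • mean (fun i => tangentProj M (x i) (v i))‖ ≤
      (2 * D) ^ 2 / (4 * γ) + α * (LP * (2 * D) * LG) := by
    rw [e4]
    simpa using norm_mean_sub_le hn (c := (0 : E)) (by simpa using e3)
  calc ‖q' - q + α • mean (fun i => tangentProj M (x i) (v i))‖
      = ‖(q' - mean x') + (mean x' - mean x + α • mean (fun i => tangentProj M (x i) (v i)))
          + (mean x - q)‖ := by congr 1; abel
    _ ≤ _ := norm_add₃_le
    -- The constant `14` is `9 + 4 + 1`.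
    _ ≤ (3 * D) ^ 2 / (4 * γ) + ((2 * D) ^ 2 / (4 * γ) + α * (LP * (2 * D) * LG))
        + D ^ 2 / (4 * γ) := by
        gcongr
        rwa [norm_sub_rev]
    _ = _ := by ring

end IsProjectedStep

end Step

/-! ### Scalar recursions and inexact descent -/

section Rates

/-- The ratio of `1/(k+2)` to `1/(k+1)` is at least `1/2`, attained at `k = 0`; a contraction factor
below `1/2` thus preserves the bound from the very first step. -/
theorem le_div_of_contraction {S : ℕ → ℝ} {B s₀ : ℝ} (hB : 0 ≤ B) (hs₀ : 0 ≤ s₀) (h0 : S 0 ≤ s₀)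
    (h : ∀ k : ℕ, S (k + 1) ≤ 49 / 100 * S k + B / ((k : ℝ) + 1)) (k : ℕ) :
    S k ≤ (100 * B + s₀) / ((k : ℝ) + 1) := by
  induction k with
  | zero => simp only [Nat.cast_zero, zero_add, div_one]; linarith
  | succ k ih =>
    push_cast
    have hk : (0 : ℝ) < (k : ℝ) + 1 := by positivity
    calc S (k + 1) ≤ 49 / 100 * ((100 * B + s₀) / ((k : ℝ) + 1)) + B / ((k : ℝ) + 1) := by
          linarith [h k]
      _ = (50 * B + 49 / 100 * s₀) / ((k : ℝ) + 1) := by ring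
      _ ≤ _ := by
          rw [div_le_div_iff₀ hk (by positivity)]
          have : (0 : ℝ) ≤ k := k.cast_nonneg
          nlinarith [mul_nonneg hB this, mul_nonneg hs₀ this]

/-- Bounding the cubes by a telescoping difference makes the descent errors summable without
discussing series. -/
theorem one_div_sqrt_pow_three_le (k : ℕ) :
    (1 / √((k : ℝ) + 1)) ^ 3 ≤ 4 * (1 / √((k : ℝ) + 1) - 1 / √(((k + 1 : ℕ) : ℝ) + 1)) := by
  push_cast
  set a := √((k : ℝ) + 1) with ha
  set b := √((k : ℝ) + 1 + 1) with hb
  have ha0 : 0 < a := by positivity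
  have hb0 : 0 < b := by positivity
  have ha2 : a ^ 2 = (k : ℝ) + 1 := Real.sq_sqrt (by positivity)
  have hb2 : b ^ 2 = a ^ 2 + 1 := by rw [ha2]; exact Real.sq_sqrt (by positivity)
  have hk : (0 : ℝ) ≤ k := k.cast_nonneg
  have h1 : b * (a + b) ≤ 4 * a ^ 2 := by nlinarith [sq_nonneg (a - b)]
  have h2 : 1 / a - 1 / b = 1 / (a * (b * (a + b))) := by
    field_simp
    linarith
  rw [h2, one_div_pow, mul_comm 4, ← div_le_iff₀ (by norm_num), div_div]
  refine one_div_le_one_div_of_le (by positivity) ?_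
  nlinarith

/-- A sufficient decrease with step sizes `1 / √(k+1)` and summable errors forces the smallest
gap to vanish at the rate `1 / √K`. -/
theorem inf'_le_of_sufficient_decrease {φ g : ℕ → ℝ} {c D F : ℝ} (hc : 0 < c) (hD : 0 ≤ D)
    (hF : ∀ k, |φ k| ≤ F)
    (h : ∀ k : ℕ, φ (k + 1) ≤
      φ k - c * (1 / √((k : ℝ) + 1)) * g k + D * (1 / √((k : ℝ) + 1)) ^ 3) (K : ℕ) :
    (Finset.range (K + 1)).inf' Finset.nonempty_range_add_one g ≤
      ((2 * F + 4 * D) / c) / √((K : ℝ) + 1) := by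
  set m := (Finset.range (K + 1)).inf' Finset.nonempty_range_add_one g with hm
  set δ : ℕ → ℝ := fun k => 1 / √((k : ℝ) + 1) with hδ
  have hF0 : 0 ≤ F := (abs_nonneg _).trans (hF 0)
  have hδ0 : ∀ k, 0 < δ k := fun k => by positivity
  -- The potential `φ k + 4 * D * δ k` absorbs the cubic errors.
  have hsum : ∀ N, c * ∑ k ∈ Finset.range N, δ k * g k ≤
      (φ 0 + 4 * D * δ 0) - (φ N + 4 * D * δ N) := by
    intro N
    induction N with
    | zero => simp
    | succ N ih =>
      rw [Finset.sum_range_succ, mul_add]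
      have h1 := h N
      have h2 := mul_le_mul_of_nonneg_left (one_div_sqrt_pow_three_le N) hD
      simp only [hδ] at ih ⊢
      linarith
  have hδone : δ 0 = 1 := by simp [hδ]
  have hsK : 0 < √((K : ℝ) + 1) := by positivity
  rcases le_or_gt m 0 with hm0 | hm0
  · exact hm0.trans (by positivity)
  have hlow : m * √((K : ℝ) + 1) ≤ ∑ k ∈ Finset.range (K + 1), δ k * g k := by
    calc m * √((K : ℝ) + 1) = ∑ k ∈ Finset.range (K + 1), δ K * m := by
          rw [Finset.sum_const, Finset.card_range, nsmul_eq_mul, hδ]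
          have := Real.sq_sqrt (show (0 : ℝ) ≤ (K : ℝ) + 1 by positivity)
          push_cast
          field_simp
          linarith
      _ ≤ _ := by
          refine Finset.sum_le_sum fun k hk => ?_
          have hkK : (k : ℝ) ≤ K := by
            exact_mod_cast Nat.lt_succ_iff.1 (Finset.mem_range.1 hk)
          refine mul_le_mul ?_ (Finset.inf'_le _ hk) hm0.le (hδ0 k).le
          exact one_div_le_one_div_of_le (by positivity) (Real.sqrt_le_sqrt (by linarith))
  rw [le_div_iff₀ hsK, le_div_iff₀ hc]
  have h1 := hsum (K + 1)
  have h2 := (abs_le.1 (hF 0)).2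
  have h3 := (abs_le.1 (hF (K + 1))).1
  have h4 : 0 ≤ 4 * D * δ (K + 1) := mul_nonneg (by linarith) (hδ0 _).le
  rw [hδone] at h1
  have h5 := mul_le_mul_of_nonneg_left hlow hc.le
  linarith

/-- The effect on a smooth function of an inexact gradient step with error of second order. -/
theorem inner_add_mul_norm_sq_le {E : Type*} [NormedAddCommGroup E] [InnerProductSpace ℝ E]
    {g u : E} {c δ Q B b : ℝ} (hc : 0 < c) (hδ : 0 < δ) (hδ1 : δ ≤ 1) (hQ : 0 ≤ Q)
    (hu : ‖u + (c * δ) • g‖ ≤ B * δ ^ 2) (hg : ‖g‖ ≤ b) :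
    inner ℝ g u + Q * ‖u‖ ^ 2 ≤
      -(c / 2 * δ * ‖g‖ ^ 2) + (B ^ 2 / c + 4 * Q ^ 2 * c ^ 3 * b ^ 2 + 2 * Q * B ^ 2) * δ ^ 3 := by
  set α := c * δ with hα
  have hα0 : 0 < α := by positivity
  set e := u + α • g with he
  have hue : u = e - α • g := by rw [he]; abel
  have he2 : ‖e‖ ^ 2 ≤ B ^ 2 * δ ^ 4 := by
    calc ‖e‖ ^ 2 ≤ (B * δ ^ 2) ^ 2 := pow_le_pow_left₀ (norm_nonneg _) hu 2
      _ = _ := by ring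
  have h1 : inner ℝ g u ≤ ‖g‖ * ‖e‖ - α * ‖g‖ ^ 2 := by
    rw [hue, inner_sub_right, inner_smul_right, real_inner_self_eq_norm_sq]
    linarith [real_inner_le_norm g e]
  have h2 : ‖u‖ ^ 2 ≤ 2 * ‖e‖ ^ 2 + 2 * (α ^ 2 * ‖g‖ ^ 2) := by
    have hn : ‖u‖ ≤ ‖e‖ + α * ‖g‖ := by
      rw [hue]
      refine (_root_.norm_sub_le _ _).trans_eq ?_
      rw [norm_smul, Real.norm_of_nonneg hα0.le]
    have := pow_le_pow_left₀ (norm_nonneg _) hn 2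
    nlinarith [sq_nonneg (‖e‖ - α * ‖g‖)]
  have h3 : ‖g‖ * ‖e‖ ≤ α * ‖g‖ ^ 2 / 4 + ‖e‖ ^ 2 / α := by
    have : 0 ≤ (α * ‖g‖ / 2 - ‖e‖) ^ 2 / α := by positivity
    have e' : (α * ‖g‖ / 2 - ‖e‖) ^ 2 / α = α * ‖g‖ ^ 2 / 4 + ‖e‖ ^ 2 / α - ‖g‖ * ‖e‖ := by
      field_simp
      ring
    linarith
  have h4 : ‖e‖ ^ 2 / α ≤ B ^ 2 / c * δ ^ 3 := by
    calc ‖e‖ ^ 2 / α ≤ B ^ 2 * δ ^ 4 / α := by gcongr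
      _ = _ := by rw [hα]; field_simp
  -- No smallness of `α` relative to `1 / Q` is required: `y ≤ 1/4 + y ^ 2` pushes the excess into
  -- the cubic error, using the bound on `g`. Together with `h3` this spends half of the decrease.
  have h5 : 2 * Q * (α ^ 2 * ‖g‖ ^ 2) ≤ α * ‖g‖ ^ 2 / 4 + 4 * Q ^ 2 * c ^ 3 * b ^ 2 * δ ^ 3 := by
    have hy : 2 * Q * α ≤ 1 / 4 + (2 * Q * α) ^ 2 := by nlinarith [sq_nonneg (2 * Q * α - 1 / 2)]
    have hg2 : ‖g‖ ^ 2 ≤ b ^ 2 := pow_le_pow_left₀ (norm_nonneg _) hg 2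
    calc 2 * Q * (α ^ 2 * ‖g‖ ^ 2) = (α * ‖g‖ ^ 2) * (2 * Q * α) := by ring
      _ ≤ (α * ‖g‖ ^ 2) * (1 / 4 + (2 * Q * α) ^ 2) := by gcongr
      _ = α * ‖g‖ ^ 2 / 4 + 4 * Q ^ 2 * α ^ 3 * ‖g‖ ^ 2 := by ring
      _ ≤ α * ‖g‖ ^ 2 / 4 + 4 * Q ^ 2 * α ^ 3 * b ^ 2 := by gcongr
      _ = _ := by rw [hα]; ring
  have h6 : 2 * Q * ‖e‖ ^ 2 ≤ 2 * Q * B ^ 2 * δ ^ 3 := by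
    calc 2 * Q * ‖e‖ ^ 2 ≤ 2 * Q * (B ^ 2 * δ ^ 4) := by gcongr
      _ = 2 * Q * B ^ 2 * δ ^ 3 * δ := by ring
      _ ≤ 2 * Q * B ^ 2 * δ ^ 3 * 1 := by gcongr
      _ = _ := by ring
  have h7 := mul_le_mul_of_nonneg_left h2 hQ
  have h8 : α * ‖g‖ ^ 2 = c * δ * ‖g‖ ^ 2 := by rw [hα]
  linarith

end Rates

/-! ### Riemannian gradients and the descent inequality -/

section Objective

variable {E : Type*} [NormedAddCommGroup E] [InnerProductSpace ℝ E] [FiniteDimensional ℝ E]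
  {n : ℕ} {M : Set E} {f : Fin n → E → ℝ} {Lf LG : ℝ}

theorem gradient_average {z : E} (hf : ∀ i, DifferentiableAt ℝ (f i) z) :
    gradient (average f) z = mean (fun i => gradient (f i) z) := by
  have h : HasFDerivAt (average f) ((n : ℝ)⁻¹ • ∑ i, fderiv ℝ (f i) z) z :=
    (HasFDerivAt.fun_sum fun i _ => (hf i).hasFDerivAt).const_mul _
  simp only [gradient, h.fderiv, mean, map_smul, map_sum]

theorem rgrad_average {z : E} (hf : ∀ i, DifferentiableAt ℝ (f i) z) :
    rgrad M (average f) z = mean (fun i => rgrad M (f i) z) := by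
  simp only [rgrad, gradient_average hf, mean, map_smul, map_sum]

namespace ObjectiveAssumption

theorem norm_rgrad_le (hf : ObjectiveAssumption M f Lf LG) (i : Fin n) {x : E} (hx : x ∈ M) :
    ‖rgrad M (f i) x‖ ≤ LG :=
  (norm_tangentProj_apply_le _ _).trans (hf.gradient_bound i x hx)

theorem norm_rgrad_sub_le (hf : ObjectiveAssumption M f Lf LG) {LP : ℝ}
    (hMLP : ∀ x ∈ M, ∀ y ∈ M, ‖tangentProj M x - tangentProj M y‖ ≤ LP * ‖x - y‖) (i : Fin n)
    {x y : E} (hx : x ∈ M) (hy : y ∈ M) :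
    ‖rgrad M (f i) x - rgrad M (f i) y‖ ≤ (Lf + LP * LG) * ‖x - y‖ := by
  have e : rgrad M (f i) x - rgrad M (f i) y = tangentProj M x (gradient (f i) x - gradient (f i) y)
      + (tangentProj M x - tangentProj M y) (gradient (f i) y) := by
    simp only [rgrad, map_sub, sub_apply]
    abel
  have h1 := (norm_tangentProj_apply_le (M := M) x (gradient (f i) x - gradient (f i) y)).trans
    (hf.gradient_lipschitz i x (subset_convexHull ℝ M hx) y (subset_convexHull ℝ M hy))
  have h2 := ContinuousLinearMap.le_of_opNorm_le_of_le _ (hMLP x hx y hy) (hf.gradient_bound i y hy)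
  rw [e]
  refine (norm_add_le _ _).trans ?_
  linarith

/-- The Riemannian descent inequality for a local objective. -/
theorem le_add_inner_rgrad (hf : ObjectiveAssumption M f Lf LG) (hLf : 0 ≤ Lf) {p : ℕ}
    (hMs : IsSmoothSubmanifold p M) (hMc : IsCompact M) {γ : ℝ} (hγ : 0 < γ)
    (hprox : IsProximallySmooth (2 * γ) M) (i : Fin n) {x y : E} (hx : x ∈ M) (hy : y ∈ M) :
    f i y ≤ f i x + inner ℝ (rgrad M (f i) x) (y - x) + (Lf + LG / (4 * γ)) * ‖y - x‖ ^ 2 := by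
  have hxc := subset_convexHull ℝ M hx
  have hyc := subset_convexHull ℝ M hy
  obtain ⟨z, hz, hfz⟩ := domain_mvt (f' := fun z => fderiv ℝ (f i) z)
    (fun z hz => (hf.differentiableAt i z hz).hasFDerivAt.hasFDerivWithinAt)
    (convex_convexHull ℝ M) hxc hyc
  have hzc : z ∈ convexHull ℝ M := (convex_convexHull ℝ M).segment_subset hxc hyc hz
  have hin : fderiv ℝ (f i) z (y - x) = inner ℝ (gradient (f i) z) (y - x) := by
    rw [gradient, InnerProductSpace.toDual_symm_apply]
  have hzx : ‖z - x‖ ≤ ‖y - x‖ := norm_sub_le_of_mem_segment hz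
  -- The normal part of the gradient pairs with `y - x` only to second order, because both points
  -- lie on `M`.
  set ν := gradient (f i) x - rgrad M (f i) x with hν
  have hνn : ∀ u ∈ tangentSpace M x, inner ℝ ν u = 0 := fun u hu =>
    Submodule.starProjection_inner_eq_zero _ u hu
  have hνle : ‖ν‖ ≤ LG := by
    refine le_trans ?_ (hf.gradient_bound i x hx)
    have e : ν = (tangentSpace M x)ᗮ.starProjection (gradient (f i) x) := by
      rw [Submodule.starProjection_orthogonal']
      rfl
    rw [e]
    exact Submodule.norm_starProjection_apply_le _ _
  have h1 : inner ℝ ν (y - x) ≤ LG / (4 * γ) * ‖y - x‖ ^ 2 := by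
    refine (hMs.inner_normal_le hMc (by positivity) hprox hx hνn hy).trans ?_
    rw [← mul_assoc, show (2 : ℝ) * 2 = 4 by norm_num]
    gcongr
  have h2 : inner ℝ (gradient (f i) z - gradient (f i) x) (y - x) ≤ Lf * ‖y - x‖ ^ 2 := by
    calc _ ≤ ‖gradient (f i) z - gradient (f i) x‖ * ‖y - x‖ := real_inner_le_norm _ _
      _ ≤ (Lf * ‖y - x‖) * ‖y - x‖ := by
          gcongr
          exact (hf.gradient_lipschitz i z hzc x hxc).trans (by gcongr)
      _ = _ := by ring
  have h3 : inner ℝ (gradient (f i) z) (y - x) =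
      inner ℝ (gradient (f i) z - gradient (f i) x) (y - x) + inner ℝ ν (y - x)
        + inner ℝ (rgrad M (f i) x) (y - x) := by
    rw [← inner_add_left, ← inner_add_left]
    congr 1
    rw [hν]; abel
  linarith

theorem average_le_add_inner_rgrad (hf : ObjectiveAssumption M f Lf LG) (hLf : 0 ≤ Lf) (hn : 0 < n)
    {p : ℕ} (hMs : IsSmoothSubmanifold p M) (hMc : IsCompact M) {γ : ℝ} (hγ : 0 < γ)
    (hprox : IsProximallySmooth (2 * γ) M) {x y : E} (hx : x ∈ M) (hy : y ∈ M) :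
    average f y ≤ average f x + (inner ℝ (rgrad M (average f) x) (y - x)
      + (Lf + LG / (4 * γ)) * ‖y - x‖ ^ 2) := by
  have hn' : (n : ℝ) ≠ 0 := by positivity
  rw [rgrad_average fun i => hf.differentiableAt i x (subset_convexHull ℝ M hx)]
  calc average f y ≤ (n : ℝ)⁻¹ * ∑ i, (f i x + inner ℝ (rgrad M (f i) x) (y - x)
        + (Lf + LG / (4 * γ)) * ‖y - x‖ ^ 2) := by
        unfold average
        gcongr with i
        exact hf.le_add_inner_rgrad hLf hMs hMc hγ hprox i hx hy
    _ = _ := by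
        rw [Finset.sum_add_distrib, Finset.sum_add_distrib, Finset.sum_const, Finset.card_univ,
          Fintype.card_fin, nsmul_eq_mul, mean, inner_smul_left, sum_inner, average]
        simp only [map_inv₀, conj_trivial]
        field_simp
        ring

end ObjectiveAssumption

end Objective

/-! ### Invariance of the neighborhood and the rates -/

section Convergence

theorem exists_stepSize_eq {γ Lf LG LP : ℝ} (hγ : 0 < γ) (hLG : 0 ≤ LG) :
    ∃ c : ℝ, 0 < c ∧ c * LG ≤ γ / 24 ∧
      ∀ k, stepSize γ (bigL γ Lf LG LP) k = c * (1 / √((k : ℝ) + 1)) := by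
  have hle : LG ≤ bigL γ Lf LG LP := le_max_left _ _
  set L := bigL γ Lf LG LP
  refine ⟨if L = 0 then 1 else min (γ / (24 * L)) 1, ?_, ?_, fun k => by
    rw [stepSize, mul_one_div]⟩
  · split_ifs with h
    · exact one_pos
    · have : 0 < L := lt_of_le_of_ne (hLG.trans hle) (Ne.symm h)
      positivity
  · split_ifs with h
    · have : LG = 0 := le_antisymm (hle.trans h.le) hLG
      rw [this, mul_zero]
      positivity
    · have : 0 < L := lt_of_le_of_ne (hLG.trans hle) (Ne.symm h)
      calc min (γ / (24 * L)) 1 * LG ≤ γ / (24 * L) * L := by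
            gcongr
            exact min_le_left _ _
        _ = γ / 24 := by field_simp

theorem norm_sub_nearest_le_two_mul {E : Type*} [NormedAddCommGroup E] [InnerProductSpace ℝ E] {n : ℕ}
    {M : Set E} {x : Fin n → E} {q : E}
    (hq : q ∈ nearestPoints M (mean x))
    {i : Fin n} (hx : x i ∈ M) : ‖x i - q‖ ≤ 2 * ‖x i - mean x‖ := by
  have h1 := hq.2 (x i) hx
  have h2 := norm_sub_le_norm_sub_add_norm_sub (x i) (mean x) q
  rw [norm_sub_rev q] at h1
  linarith

variable {E : Type*} [NormedAddCommGroup E] [InnerProductSpace ℝ E] [FiniteDimensional ℝ E]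
  {n t : ℕ} {M : Set E} {γ : ℝ} {G : SimpleGraph (Fin n)} {W : Matrix (Fin n) (Fin n) ℝ}

theorem NetworkAssumption.sq_sigmaTwo_pow_le (hW : NetworkAssumption G W) (ht1 : 1 ≤ t)
    (ht : ⌈Real.logb (sigmaTwo W) (1 / 2)⌉ ≤ (t : ℤ)) : (sigmaTwo W ^ t) ^ 2 ≤ 1 / 4 := by
  rcases hW.sigmaTwo_nonneg.eq_or_lt with h | h
  · rw [← h, zero_pow (by omega)]
    norm_num
  · have := pow_le_of_ceil_logb_le h hW.sigmaTwo_lt_one (by norm_num) ht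
    calc (sigmaTwo W ^ t) ^ 2 ≤ (1 / 2) ^ 2 := by gcongr
      _ = 1 / 4 := by norm_num

/-- Bounding one agent by the sum over all agents costs `√n`, which the threshold contains. If `σ₂ =
0`, the power vanishes since `1 ≤ t`; if the diameter is `0`, so does the deviation. -/
theorem NetworkAssumption.norm_pow_sub_mean_le (hW : NetworkAssumption G W) (hM : IsCompact M)
    (hγ : 0 < γ) (ht1 : 1 ≤ t)
    (ht : ⌈Real.logb (sigmaTwo W) (γ / (24 * √(n : ℝ) * Metric.diam M))⌉ ≤ (t : ℤ))
    {x : Fin n → E} (hx : ∀ i, x i ∈ M) (i : Fin n) :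
    ‖∑ j, (W ^ t) i j • x j - mean x‖ ≤ γ / 24 := by
  have hn : 0 < n := Fin.pos i
  set ζ := Metric.diam M with hζ
  have hζ0 : 0 ≤ ζ := Metric.diam_nonneg
  have hdist : ∀ j, ‖x j - mean x‖ ≤ ζ := fun j => by
    rw [norm_sub_rev]
    refine norm_mean_sub_le hn fun l => ?_
    rw [← dist_eq_norm]
    exact Metric.dist_le_diam_of_mem hM.isBounded (hx l) (hx j)
  have hmain : ‖∑ j, (W ^ t) i j • x j - mean x‖ ^ 2 ≤ (sigmaTwo W ^ t * √n * ζ) ^ 2 := by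
    calc _ ≤ ∑ l, ‖∑ j, (W ^ t) l j • x j - mean x‖ ^ 2 :=
          Finset.single_le_sum (f := fun l => ‖∑ j, (W ^ t) l j • x j - mean x‖ ^ 2)
            (fun _ _ => by positivity) (Finset.mem_univ i)
      _ ≤ (sigmaTwo W ^ t) ^ 2 * ∑ l, ‖x l - mean x‖ ^ 2 := hW.sum_norm_sq_pow_sub_mean_le t x
      _ ≤ (sigmaTwo W ^ t) ^ 2 * ∑ _l : Fin n, ζ ^ 2 := by
          gcongr with l
          exact hdist l
      _ = (sigmaTwo W ^ t * √n * ζ) ^ 2 := by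
          rw [Finset.sum_const, Finset.card_univ, Fintype.card_fin, nsmul_eq_mul, mul_pow, mul_pow,
            Real.sq_sqrt (Nat.cast_nonneg n)]
          ring
  have hσ0 := hW.sigmaTwo_nonneg
  refine (abs_le_of_sq_le_sq' hmain (by positivity)).2.trans ?_
  rcases hσ0.eq_or_lt with h | h
  · rw [← h, zero_pow (by omega), zero_mul, zero_mul]
    positivity
  rcases hζ0.eq_or_lt with h' | h'
  · rw [← h', mul_zero]
    positivity
  have := pow_le_of_ceil_logb_le h hW.sigmaTwo_lt_one (by positivity) ht
  calc sigmaTwo W ^ t * √n * ζ ≤ γ / (24 * √(n : ℝ) * ζ) * √n * ζ := by gcongr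
    _ = γ / 24 := by field_simp

theorem isProjectedStep_iterates (hM : IsCompact M) (hγ : 0 < γ)
    (hprox : IsProximallySmooth (2 * γ) M) (hW : NetworkAssumption G W) {f : Fin n → E → ℝ}
    {Lf LG : ℝ} (hf : ObjectiveAssumption M f Lf LG) {c : ℝ} (hc : 0 < c)
    (hcLG : c * LG ≤ γ / 24) {α : ℕ → ℝ} (hα : ∀ k : ℕ, α k = c * (1 / √((k : ℝ) + 1)))
    (hmix : ∀ x : Fin n → E, (∀ i, x i ∈ M) → ∀ i, ‖∑ j, (W ^ t) i j • x j - mean x‖ ≤ γ / 24)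
    {x : ℕ → Fin n → E} {q : ℕ → E} (h0 : x 0 ∈ consensusNhd n M γ) (hx : IsDPRGD M W t f α x)
    (hq : ∀ k, q k ∈ nearestPoints M (mean (x k))) (k : ℕ) :
    IsProjectedStep M γ (W ^ t) (x k) (q k)
      (fun i => α k • tangentProj M (x k i) (gradient (f i) (x k i))) (x (k + 1)) := by
  obtain ⟨i₀⟩ := hW.connected.nonempty
  have hn : 0 < n := Fin.pos i₀
  have hmem : ∀ k i, x k i ∈ M := fun k => by
    cases k with
    | zero => exact h0.1
    | succ k => exact fun i => (hx k i).1
  have hδ1 : ∀ k : ℕ, 1 / √((k : ℝ) + 1) ≤ 1 := fun k => by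
    rw [div_le_one (by positivity), Real.one_le_sqrt]
    linarith [k.cast_nonneg (α := ℝ)]
  have hstep : ∀ k, (∀ i, ‖x k i - q k‖ ≤ γ / 2) → IsProjectedStep M γ (W ^ t) (x k) (q k)
      (fun i => α k • tangentProj M (x k i) (gradient (f i) (x k i))) (x (k + 1)) := by
    intro k hk
    refine ⟨hW.pow_mem t, hmem k, hq k, hk, fun i => ?_, fun i => hx k i⟩
    have hα0 : 0 ≤ α k := by rw [hα]; positivity
    rw [norm_smul, Real.norm_of_nonneg hα0]
    calc α k * ‖tangentProj M (x k i) (gradient (f i) (x k i))‖ ≤ c * 1 * LG := by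
          rw [hα]
          gcongr
          · exact hδ1 k
          · exact hf.norm_rgrad_le i (hmem k i)
      _ ≤ γ / 24 := by linarith
  refine hstep k ?_
  induction k with
  | zero =>
    obtain ⟨-, q', hq', hnear⟩ := h0
    have hd : ‖q' - mean (x 0)‖ < 2 * γ := by
      rw [norm_sub_rev]
      exact (norm_mean_sub_le hn hnear).trans_lt (by linarith)
    -- The neighborhood supplies some nearest point; it equals `q 0` because the initial mean lies
    -- inside the tube of uniqueness.
    rwa [hprox.eq_of_mem hq' (hq 0) hd]
  | succ k ih => exact (hstep k ih).near_next hγ hM hprox (hmix _ (hmem k)) (hq (k + 1))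

/-- Convergence of decentralized projected Riemannian gradient descent, in an arbitrary
finite-dimensional inner product space. -/
theorem exists_rates (hM : IsCompact M) {p : ℕ} (hMs : IsSmoothSubmanifold p M) (hγ : 0 < γ)
    (hprox : IsProximallySmooth (2 * γ) M) {LP : ℝ} (hLP : 0 ≤ LP)
    (hMLP : ∀ x ∈ M, ∀ y ∈ M, ‖tangentProj M x - tangentProj M y‖ ≤ LP * ‖x - y‖)
    (hW : NetworkAssumption G W) {f : Fin n → E → ℝ} {Lf LG : ℝ} (hLf : 0 ≤ Lf) (hLG : 0 ≤ LG)
    (hf : ObjectiveAssumption M f Lf LG) (ht1 : 1 ≤ t)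
    (ht : max ⌈Real.logb (sigmaTwo W) (1 / 2)⌉
        ⌈Real.logb (sigmaTwo W) (γ / (24 * √(n : ℝ) * Metric.diam M))⌉ ≤ (t : ℤ)) :
    ∃ C₁ C₂ : ℝ, ∀ (x : ℕ → Fin n → E) (q : ℕ → E), x 0 ∈ consensusNhd n M γ →
      IsDPRGD M W t f (stepSize γ (bigL γ Lf LG LP)) x →
      (∀ k, q k ∈ nearestPoints M (mean (x k))) →
        (∀ K : ℕ, 1 ≤ K → (1 / (n : ℝ)) * ∑ i, ‖q K - x K i‖ ^ 2 ≤ C₁ / (K : ℝ)) ∧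
        (∀ K : ℕ, (Finset.range (K + 1)).inf' Finset.nonempty_range_add_one
            (fun k => ‖rgrad M (average f) (q k)‖ ^ 2) ≤ C₂ / √((K : ℝ) + 1)) := by
  obtain ⟨i₀⟩ := hW.connected.nonempty
  have hn : 0 < n := Fin.pos i₀
  obtain ⟨c, hc, hcLG, hα⟩ := exists_stepSize_eq (Lf := Lf) (LP := LP) hγ hLG
  set α := stepSize γ (bigL γ Lf LG LP)
  have hmix : ∀ x : Fin n → E, (∀ i, x i ∈ M) →
      ∀ i, ‖∑ j, (W ^ t) i j • x j - mean x‖ ≤ γ / 24 := fun x hx i =>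
    hW.norm_pow_sub_mean_le hM hγ ht1 ((le_max_right _ _).trans ht) hx i
  have hσ := hW.sq_sigmaTwo_pow_le ht1 ((le_max_left _ _).trans ht)
  have hcont : ContinuousOn (average f) M := fun z hz => by
    refine ContinuousAt.continuousWithinAt ?_
    have : ∀ i, ContinuousAt (f i) z := fun i =>
      (hf.differentiableAt i z (subset_convexHull ℝ M hz)).continuousAt
    unfold average
    fun_prop
  obtain ⟨F, hF⟩ := hM.exists_bound_of_continuousOn hcont
  set B := (n : ℝ) * (32 * (c * LG) ^ 2) with hBdef
  have hB : 0 ≤ B := by positivity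
  set s₀ := (n : ℝ) * (γ / 2) ^ 2 with hs₀def
  have hs₀ : 0 ≤ s₀ := by positivity
  set A := 100 * B + s₀ with hAdef
  have hA : 0 ≤ A := by positivity
  -- One constant for both the current and the next agents' distance to `q k`: the former needs `4 *
  -- A`, the latter `0.49 * A + B`.
  set C := √(4 * A + B) with hCdef
  have hC2 : C ^ 2 = 4 * A + B := Real.sq_sqrt (by positivity)
  have hC : 0 ≤ C := Real.sqrt_nonneg _
  set Q := Lf + LG / (4 * γ) with hQdef
  have hQ : 0 ≤ Q := by positivity
  set R := 14 * C ^ 2 / (4 * γ) + 2 * c * LP * LG * C + c * ((Lf + LP * LG) * C) with hRdef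
  set D := R ^ 2 / c + 4 * Q ^ 2 * c ^ 3 * LG ^ 2 + 2 * Q * R ^ 2 with hDdef
  have hD : 0 ≤ D := by positivity
  refine ⟨1 / (n : ℝ) * (4 * A), (2 * F + 4 * D) / (c / 2), fun x q h0 hx hq => ?_⟩
  have hstep := isProjectedStep_iterates hM hγ hprox hW hf hc hcLG hα hmix h0 hx hq
  have hαLG : ∀ k i, ‖α k • tangentProj M (x k i) (gradient (f i) (x k i))‖ ≤
      c * LG * (1 / √((k : ℝ) + 1)) := fun k i => by
    have hα0 : 0 ≤ α k := by rw [hα]; positivity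
    rw [norm_smul, Real.norm_of_nonneg hα0, hα]
    calc _ ≤ c * (1 / √((k : ℝ) + 1)) * LG := by
          gcongr
          exact hf.norm_rgrad_le i ((hstep k).mem i)
      _ = _ := by ring
  have hδ2 : ∀ k : ℕ, (1 / √((k : ℝ) + 1)) ^ 2 = 1 / ((k : ℝ) + 1) := fun k => by
    rw [div_pow, Real.sq_sqrt (by positivity), one_pow]
  have hnext : ∀ k : ℕ, ∑ i, ‖x (k + 1) i - q k‖ ^ 2 ≤
      49 / 100 * (∑ i, ‖x k i - mean (x k)‖ ^ 2) + B / ((k : ℝ) + 1) := fun k => by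
    have := (hstep k).sum_norm_sq_next_le hγ hM hprox (hαLG k)
      ((hW.sum_norm_sq_pow_sub_mean_le t (x k)).trans
        (mul_le_mul_of_nonneg_right hσ (by positivity)))
    refine this.trans_eq ?_
    rw [mul_pow, hδ2, hBdef]
    ring
  have hV : ∀ k : ℕ, ∑ i, ‖x k i - mean (x k)‖ ^ 2 ≤ A / ((k : ℝ) + 1) := by
    refine le_div_of_contraction (S := fun k => ∑ i, ‖x k i - mean (x k)‖ ^ 2) hB hs₀ ?_
      fun k => (sum_norm_sub_mean_sq_le hn _ (q k)).trans (hnext k)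
    refine (sum_norm_sub_mean_sq_le hn _ (q 0)).trans ?_
    calc ∑ i, ‖x 0 i - q 0‖ ^ 2 ≤ ∑ _i : Fin n, (γ / 2) ^ 2 := by
          gcongr with i
          exact (hstep 0).near i
      _ = s₀ := by rw [Finset.sum_const, Finset.card_univ, Fintype.card_fin, nsmul_eq_mul]
  have hcons : ∀ k : ℕ, ∑ i, ‖x k i - q k‖ ^ 2 ≤ 4 * A / ((k : ℝ) + 1) := fun k => by
    calc ∑ i, ‖x k i - q k‖ ^ 2 ≤ ∑ i, (2 * ‖x k i - mean (x k)‖) ^ 2 := by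
          gcongr with i
          exact norm_sub_nearest_le_two_mul (hq k) ((hstep k).mem i)
      _ = 4 * ∑ i, ‖x k i - mean (x k)‖ ^ 2 := by
          rw [Finset.mul_sum]
          exact Finset.sum_congr rfl fun i _ => by ring
      _ ≤ 4 * (A / ((k : ℝ) + 1)) := by gcongr; exact hV k
      _ = _ := by ring
  have hroot : ∀ (k : ℕ) (u : Fin n → E), ∑ i, ‖u i‖ ^ 2 ≤ (4 * A + B) / ((k : ℝ) + 1) →
      ∀ i, ‖u i‖ ≤ C * (1 / √((k : ℝ) + 1)) := fun k u hu i => by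
    refine (abs_le_of_sq_le_sq' ?_ (by positivity)).2
    rw [mul_pow, hδ2, hC2, mul_one_div]
    exact (Finset.single_le_sum (f := fun i => ‖u i‖ ^ 2) (fun _ _ => by positivity)
      (Finset.mem_univ i)).trans hu
  have hCx : ∀ k i, ‖x k i - q k‖ ≤ C * (1 / √((k : ℝ) + 1)) := fun k =>
    hroot k _ ((hcons k).trans (by gcongr; linarith))
  have hCx' : ∀ k i, ‖x (k + 1) i - q k‖ ≤ C * (1 / √((k : ℝ) + 1)) := fun k => by
    refine hroot k _ ((hnext k).trans ?_)
    calc _ ≤ 49 / 100 * (A / ((k : ℝ) + 1)) + B / ((k : ℝ) + 1) := by gcongr; exact hV k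
      _ = (49 / 100 * A + B) / ((k : ℝ) + 1) := by ring
      _ ≤ _ := by gcongr; norm_num
  constructor
  · intro K hK
    have hK' : (0 : ℝ) < K := by exact_mod_cast hK
    rw [mul_div_assoc]
    gcongr
    calc ∑ i, ‖q K - x K i‖ ^ 2 = ∑ i, ‖x K i - q K‖ ^ 2 := by simp_rw [norm_sub_rev]
      _ ≤ 4 * A / ((K : ℝ) + 1) := hcons K
      _ ≤ 4 * A / (K : ℝ) := by gcongr; linarith
  · refine inf'_le_of_sufficient_decrease (φ := fun k => average f (q k)) (by positivity) hD
      (fun k => hF _ (hq k).1) fun k => ?_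
    set δ := 1 / √((k : ℝ) + 1) with hδ
    have hδ0 : 0 < δ := by positivity
    have hδ1 : δ ≤ 1 := by
      rw [hδ, div_le_one (by positivity), Real.one_le_sqrt]
      linarith [k.cast_nonneg (α := ℝ)]
    have hdiff : ∀ z ∈ M, ∀ i, DifferentiableAt ℝ (f i) z := fun z hz i =>
      hf.differentiableAt i z (subset_convexHull ℝ M hz)
    -- Two errors combine: the motion of the induced means, and the evaluation of gradients at the
    -- agents instead of at `q k`. With disagreement `C * δ`, both are of order `δ ^ 2`.
    have herr : ‖q (k + 1) - q k + (c * δ) • rgrad M (average f) (q k)‖ ≤ R * δ ^ 2 := by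
      have h1 := (hstep k).norm_center_sub_le hγ hM hprox hn hLP hMLP (D := C * δ)
        (by rw [hα]; positivity) (fun i => hf.gradient_bound i _ ((hstep k).mem i)) (hq (k + 1))
        (hstep (k + 1)).near (hCx k) (hCx' k)
      have h2 : ‖rgrad M (average f) (q k) - mean (fun i => rgrad M (f i) (x k i))‖ ≤
          (Lf + LP * LG) * (C * δ) := by
        rw [rgrad_average (hdiff _ (hq k).1)]
        refine norm_mean_sub_mean_le hn fun i => ?_
        refine (hf.norm_rgrad_sub_le hMLP i (hq k).1 ((hstep k).mem i)).trans ?_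
        rw [norm_sub_rev]
        gcongr
        exact hCx k i
      rw [hα k] at h1
      have e : q (k + 1) - q k + (c * δ) • rgrad M (average f) (q k) =
          (q (k + 1) - q k + (c * δ) • mean (fun i => rgrad M (f i) (x k i))) +
            (c * δ) • (rgrad M (average f) (q k) - mean (fun i => rgrad M (f i) (x k i))) := by
        rw [smul_sub]; abel
      rw [e]
      refine (norm_add_le _ _).trans ?_
      rw [norm_smul, Real.norm_of_nonneg (by positivity)]
      calc _ ≤ (14 * (C * δ) ^ 2 / (4 * γ) + 2 * (c * δ) * LP * LG * (C * δ))
            + c * δ * ((Lf + LP * LG) * (C * δ)) := by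
            gcongr
            exact h1
        _ = R * δ ^ 2 := by rw [hRdef]; ring
    have hgrad : ‖rgrad M (average f) (q k)‖ ≤ LG := by
      rw [rgrad_average (hdiff _ (hq k).1)]
      simpa using norm_mean_sub_le hn (c := (0 : E)) (x := fun i => rgrad M (f i) (q k))
        (by simpa using fun i => hf.norm_rgrad_le i (hq k).1)
    have h3 := hf.average_le_add_inner_rgrad hLf hn hMs hM hγ hprox (hq k).1 (hq (k + 1)).1
    have h4 := inner_add_mul_norm_sq_le hc hδ0 hδ1 hQ herr hgrad
    linarith

end Convergence

end DPRGD

open DPRGD in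
theorem mainTheorem4 {d r p n : ℕ}
    -- the compact smooth submanifold `M` of `ℝ^{d×r}` (Frobenius norm), `2γ`-proximally smooth
    (M : Set (EuclideanSpace ℝ (Fin d × Fin r)))
    (hMcompact : IsCompact M) (hMsmooth : IsSmoothSubmanifold p M)
    (γ : ℝ) (hγ : 0 < γ) (hMprox : IsProximallySmooth (2 * γ) M)
    -- a Lipschitz modulus `LP` of `x ↦ P_{T_x M}` over `M`
    (LP : ℝ) (hLP : 0 < LP)
    (hMLP : ∀ x ∈ M, ∀ y ∈ M, ‖tangentProj M x - tangentProj M y‖ ≤ LP * ‖x - y‖)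
    -- the network
    (G : SimpleGraph (Fin n)) (W : Matrix (Fin n) (Fin n) ℝ) (hW : NetworkAssumption G W)
    -- the local objectives
    (f : Fin n → EuclideanSpace ℝ (Fin d × Fin r) → ℝ) (Lf LG : ℝ) (hLf : 0 ≤ Lf) (hLG : 0 ≤ LG)
    (hf : ObjectiveAssumption M f Lf LG)
    -- the number `t` of consensus steps
    (t : ℕ) (ht1 : 1 ≤ t)
    (ht : max ⌈Real.logb (sigmaTwo W) (1 / 2)⌉
        ⌈Real.logb (sigmaTwo W) (γ / (24 * √(n : ℝ) * Metric.diam M))⌉ ≤ (t : ℤ)) :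
    ∃ C₁ C₂ : ℝ, ∀ (x : ℕ → Fin n → EuclideanSpace ℝ (Fin d × Fin r))
      (xbar : ℕ → EuclideanSpace ℝ (Fin d × Fin r)),
      x 0 ∈ consensusNhd n M γ →
      IsDPRGD M W t f (stepSize γ (bigL γ Lf LG LP)) x →
      (∀ k, xbar k ∈ nearestPoints M (mean (x k))) →
        (∀ K : ℕ, 1 ≤ K → (1 / (n : ℝ)) * ∑ i, ‖xbar K - x K i‖ ^ 2 ≤ C₁ / (K : ℝ)) ∧
        (∀ K : ℕ, (Finset.range (K + 1)).inf' Finset.nonempty_range_add_one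
            (fun k => ‖rgrad M (average f) (xbar k)‖ ^ 2) ≤ C₂ / √((K : ℝ) + 1)) :=
  exists_rates hMcompact hMsmooth hγ hMprox hLP.le hMLP hW hLf hLG hf ht1 ht
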